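/- **Theorem.** Let $n\ge 2$ be even and let $v_0,\dots,v_{n-1}$ be the vertices of a convex polygon in the plane ($n$ distinct points in convex position, no vertex in the convex hull of the others), labelled in counterclockwise order; indices are taken modulo $n$. A *matching* is a perfect matching of the points by straight line segments that do not cross (distinct segments are disjoint); its *value* is the length of its longest segment. A pair $(i,j)$ is *feasible* if the cyclic sequence $i,i+1,\dots,j$ has an even number of terms. Let $\tau(i,j)\in[0,2\pi)$ be the angle by which the vector $\overrightarrow{v_iv_{i+1}}$ has to be rotated counterclockwise to align with $\overrightarrow{v_{j-1}v_j}$. Consider the following algorithm. 1. For all $i$ set $S[i,i]=0$, $S[i,i+1]=|v_iv_{i+1}|$ and $necessary(i,i+1)=\top$. Then, in the order of increasing cyclic distance $j-i=3,5,\dots,n-1$, compute for all such pairs $$a=\max\{S[i+1,j-1],|v_iv_j|\},\quad b=\max\{S[i+2,j],|v_iv_{i+1}|\},\quad c=\max\{S[i,j-2],|v_{j-1}v_j|\},$$ set $S[i,j]=\min\{a,b,c\}$, and set $necessary(i,j)=\top$ if $a<b$ and $a<c$, and $necessary(i,j)=\bot$ otherwise. 2. Set $best=\min\{S[i+1,i]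 : 0\le i\le n-1\}$. 3. For every feasible pair $(i,j)$ with $necessary(i,j)=\top$ and $\tau(i,j)\le 2\pi/3$, and for every $k$ among the remaining vertices $j+1,\dots,i-1$ (none if $i=j+1$) such that $(j+1,k)$ is feasible, replace $best$ by $\min\{best,\max\{S[i,j],S[j+1,k],S[k+1,i-1]\}\}$. Then, at the end, $best$ is the minimum of the values of all matchings of $v_0,\dots,v_{n-1}$ (the value of a bottleneck matching), and the algorithm runs in $O(n^2)$ time: there is an absolute constant $C$ such that, written as a program for a real RAM in which each elementary operation (integer and real arithmetic, square root, direction angle of a vector, comparison, array access, assignment, branching, loop iteration) costs one step, it performs at most $C n^2$ steps on every such input. -/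

import Mathlib

noncomputable section

namespace Bottleneck

/-! ## Geometry: points in convex position, non-crossing matchings, their value -/

abbrev Plane : Type := EuclideanSpace ℝ (Fin 2)

/-- Twice the signed area of the triangle `p q r`; positive iff `p, q, r` make a left turn. -/
def orient (p q r : Plane) : ℝ :=
  (q 0 - p 0) * (r 1 - p 1) - (q 1 - p 1) * (r 0 - p 0)

/-- The points `v 0, …, v (n - 1)` are distinct, in convex position (none of them lies in the convex
hull of the others), and are labelled in counterclockwise order along the convex polygon. -/
structure IsConvexCCW {n : ℕ} (v : Fin n → Plane) : Prop where
  convexIndependent : ConvexIndependent ℝ v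
  ccw : ∀ i j k : Fin n, i < j → j < k → 0 < orient (v i) (v j) (v k)

/-- A non-crossing perfect matching of the points `v`, given by the map sending each point to its
partner: each point is an endpoint of exactly one segment, joining it to another point, and
different segments have no common point. -/
structure IsNonCrossingMatching {n : ℕ} (v : Fin n → Plane) (σ : Fin n → Fin n) : Prop where
  involutive : ∀ i, σ (σ i) = i
  ne_self : ∀ i, σ i ≠ i
  nonCrossing : ∀ i k, k ≠ i → k ≠ σ i →
    Disjoint (segment ℝ (v i) (v (σ i))) (segment ℝ (v k) (v (σ k)))

/-- `b` is the value of the matching `σ`: the length of a longest segment in it. -/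
def IsMatchingValue {n : ℕ} (v : Fin n → Plane) (σ : Fin n → Fin n) (b : ℝ) : Prop :=
  IsGreatest (Set.range fun i => dist (v i) (v (σ i))) b

/-- The set of the values of all non-crossing perfect matchings. -/
def matchingValues {n : ℕ} (v : Fin n → Plane) : Set ℝ :=
  {b | ∃ σ, IsNonCrossingMatching v σ ∧ IsMatchingValue v σ b}

/-! ## The machine: structured programs for a real RAM, with unit costs

Programs act on integer registers, real registers and two-dimensional arrays of reals and of
truth values. Every literal, register access, array access, arithmetic operation, comparison,
connective, assignment, branching and loop iteration costs one step. -/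

/-- Names of the integer registers. -/
inductive IVar
  | n | i | j | k | d | e
deriving DecidableEq

/-- Names of the real registers. -/
inductive RVar
  | a | b | c | theta | best
deriving DecidableEq

/-- Names of the arrays of reals: the input coordinates and the table `S`. -/
inductive RArr
  | coord | S
deriving DecidableEq

/-- Names of the arrays of truth values. -/
inductive BArr
  | necessary
deriving DecidableEq

structure State where
  int : IVar → ℕ
  real : RVar → ℝ
  arr : RArr × ℕ × ℕ → ℝ
  flag : BArr × ℕ × ℕ → Prop

/-- Integer expressions. -/
inductive IExp
  | lit (c : ℕ)
  | var (x : IVar)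
  | add (p q : IExp)
  | sub (p q : IExp)
  | mul (p q : IExp)
  | div (p q : IExp)
  | mod (p q : IExp)

namespace IExp

instance (c : ℕ) : OfNat IExp c := ⟨lit c⟩
instance : Add IExp := ⟨add⟩
instance : Sub IExp := ⟨sub⟩
instance : Mul IExp := ⟨mul⟩
instance : Div IExp := ⟨div⟩
instance : Mod IExp := ⟨mod⟩

def eval (s : State) : IExp → ℕ
  | lit c => c
  | var x => s.int x
  | add p q => p.eval s + q.eval s
  | sub p q => p.eval s - q.eval s
  | mul p q => p.eval s * q.eval s
  | div p q => p.eval s / q.eval s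
  | mod p q => p.eval s % q.eval s

def cost : IExp → ℕ
  | lit _ => 1
  | var _ => 1
  | add p q => 1 + p.cost + q.cost
  | sub p q => 1 + p.cost + q.cost
  | mul p q => 1 + p.cost + q.cost
  | div p q => 1 + p.cost + q.cost
  | mod p q => 1 + p.cost + q.cost

end IExp

/-- Real expressions. -/
inductive RExp
  | lit (c : ℕ)
  | pi
  | var (x : RVar)
  | get (A : RArr) (p q : IExp)
  | add (x y : RExp)
  | sub (x y : RExp)
  | mul (x y : RExp)
  | div (x y : RExp)
  | min (x y : RExp)
  | max (x y : RExp)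
  | sqrt (x : RExp)
  /-- The direction of the vector `(x, y)`, an angle in `(-π, π]`. -/
  | arg (x y : RExp)

namespace RExp

instance (c : ℕ) : OfNat RExp c := ⟨lit c⟩
instance : Add RExp := ⟨add⟩
instance : Sub RExp := ⟨sub⟩
instance : Mul RExp := ⟨mul⟩
instance : Div RExp := ⟨div⟩

def eval (s : State) : RExp → ℝ
  | lit c => c
  | pi => Real.pi
  | var x => s.real x
  | get A p q => s.arr (A, p.eval s, q.eval s)
  | add x y => x.eval s + y.eval s
  | sub x y => x.eval s - y.eval s
  | mul x y => x.eval s * y.eval s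
  | div x y => x.eval s / y.eval s
  | min x y => Min.min (x.eval s) (y.eval s)
  | max x y => Max.max (x.eval s) (y.eval s)
  | sqrt x => Real.sqrt (x.eval s)
  | arg x y => Complex.arg ⟨x.eval s, y.eval s⟩

def cost : RExp → ℕ
  | lit _ => 1
  | pi => 1
  | var _ => 1
  | get _ p q => 1 + p.cost + q.cost
  | add x y => 1 + x.cost + y.cost
  | sub x y => 1 + x.cost + y.cost
  | mul x y => 1 + x.cost + y.cost
  | div x y => 1 + x.cost + y.cost
  | min x y => 1 + x.cost + y.cost
  | max x y => 1 + x.cost + y.cost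
  | sqrt x => 1 + x.cost
  | arg x y => 1 + x.cost + y.cost

end RExp

/-- Tests. -/
inductive BExp
  | tt
  | le (x y : RExp)
  | lt (x y : RExp)
  | get (A : BArr) (p q : IExp)
  | and (x y : BExp)

namespace BExp

def eval (s : State) : BExp → Prop
  | tt => True
  | le x y => x.eval s ≤ y.eval s
  | lt x y => x.eval s < y.eval s
  | get A p q => s.flag (A, p.eval s, q.eval s)
  | and x y => x.eval s ∧ y.eval s

def cost : BExp → ℕ
  | tt => 1
  | le x y => 1 + x.cost + y.cost
  | lt x y => 1 + x.cost + y.cost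
  | get _ p q => 1 + p.cost + q.cost
  | and x y => 1 + x.cost + y.cost

end BExp

/-- Commands. `forLoop x p c` executes `c` for `x = 0, …, p - 1` in this order, where the
bound `p` is evaluated once, before the first iteration. -/
inductive Cmd
  | skip
  | setInt (x : IVar) (p : IExp)
  | setReal (x : RVar) (y : RExp)
  | store (A : RArr) (p q : IExp) (y : RExp)
  | storeFlag (A : BArr) (p q : IExp) (b : BExp)
  | seq (c₁ c₂ : Cmd)
  | ite (b : BExp) (c₁ c₂ : Cmd)
  | forLoop (x : IVar) (p : IExp) (c : Cmd)

namespace Cmd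

/-- Run `body 0, …, body (m - 1)` one after the other, adding up the steps. -/
def iterate (body : ℕ → State → State × ℕ) : ℕ → State → State × ℕ
  | 0, s => (s, 0)
  | m + 1, s =>
    let p := iterate body m s
    let q := body m p.1
    (q.1, p.2 + (1 + q.2))

open Classical in
/-- Execution of a command: the final state and the number of steps. -/
def exec : Cmd → State → State × ℕ
  | skip, s => (s, 1)
  | setInt x p, s => ({ s with int := Function.update s.int x (p.eval s) }, 1 + p.cost)
  | setReal x y, s => ({ s with real := Function.update s.real x (y.eval s) }, 1 + y.cost)
  | store A p q y, s =>
    ({ s with arr := Function.update s.arr (A, p.eval s, q.eval s) (y.eval s) },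
      1 + p.cost + q.cost + y.cost)
  | storeFlag A p q b, s =>
    ({ s with flag := Function.update s.flag (A, p.eval s, q.eval s) (b.eval s) },
      1 + p.cost + q.cost + b.cost)
  | seq c₁ c₂, s =>
    let p := exec c₁ s
    let q := exec c₂ p.1
    (q.1, p.2 + q.2)
  | ite b c₁ c₂, s =>
    let p := if b.eval s then exec c₁ s else exec c₂ s
    (p.1, 1 + b.cost + p.2)
  | forLoop x p c, s =>
    let r := iterate (fun t s' => exec c { s' with int := Function.update s'.int x t })
      (p.eval s) s
    (r.1, 1 + p.cost + r.2)

/-- Sequential composition of a list of commands. -/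
def block : List Cmd → Cmd
  | [] => skip
  | c :: cs => seq c (block cs)

end Cmd

/-! ## The algorithm -/

namespace Algorithm

abbrev n : IExp := .var .n
abbrev i : IExp := .var .i
abbrev j : IExp := .var .j
abbrev k : IExp := .var .k
abbrev d : IExp := .var .d
abbrev e : IExp := .var .e

/-- The vertex that is `t` places after vertex `p`, indices being taken modulo `n`. -/
def fwd (p t : IExp) : IExp := (p + t) % n

/-- The vertex that is `t ≤ n` places before vertex `p`, indices being taken modulo `n`. -/
def bwd (p t : IExp) : IExp := (p + (n - t)) % n

/-- The table entry `S[p, q]`. -/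
def tab (p q : IExp) : RExp := .get .S p q

def xc (p : IExp) : RExp := .get .coord p 0
def yc (p : IExp) : RExp := .get .coord p 1

/-- The distance between the vertices `p` and `q`. -/
def len (p q : IExp) : RExp :=
  .sqrt ((xc p - xc q) * (xc p - xc q) + (yc p - yc q) * (yc p - yc q))

/-- The direction of the vector from vertex `p` to vertex `q`. -/
def dir (p q : IExp) : RExp := .arg (xc q - xc p) (yc q - yc p)

/-- `S[i, i] ← 0`, and the subproblems with `j = i + 1`, whose only solution is the edge `(i, j)`,
so that `(i, j)` is necessary. -/
def initTable : Cmd :=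
  .forLoop .i n (.block [
    .store .S i i 0,
    .setInt .j (fwd i 1),
    .store .S i j (len i j),
    .storeFlag .necessary i j .tt])

/-- The other subproblems `(i, j)`, in the order of increasing `j - i = 3, 5, …, n - 1`.
The three cases of the recurrence are `a`, `b`, `c`, and `(i, j)` is marked as
necessary iff the minimum is attained in the first case only. -/
def fillTable : Cmd :=
  .forLoop .d (n / 2 - 1) (.forLoop .i n (.block [
    .setInt .j (fwd i (2 * d + 3)),
    .setReal .a (.max (tab (fwd i 1) (bwd j 1)) (len i j)),
    .setReal .b (.max (tab (fwd i 2) j) (len i (fwd i 1))),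
    .setReal .c (.max (tab i (bwd j 2)) (len (bwd j 1) j)),
    .store .S i j (.min (.var .a) (.min (.var .b) (.var .c))),
    .storeFlag .necessary i j
      (.and (.lt (.var .a) (.var .b)) (.lt (.var .a) (.var .c)))]))

/-- `best ← min {S[i + 1, i]}`. -/
def oneCascade : Cmd :=
  .block [
    .setReal .best (tab (fwd 0 1) 0),
    .forLoop .i n (.setReal .best (.min (.var .best) (tab (fwd i 1) i)))]

/-- `theta ← τ(i, j)`: the angle in `[0, 2π)` by which the vector from vertex `i` to vertex `i + 1`
has to be rotated counterclockwise to align with the vector from vertex `j - 1` to vertex `j`. -/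
def turningAngle : Cmd :=
  .block [
    .setReal .theta (dir (bwd j 1) j - dir i (fwd i 1)),
    .ite (.lt (.var .theta) 0)
      (.setReal .theta (.var .theta + 2 * .pi))
      .skip]

/-- For all feasible pairs `(i, j)`, that is, `j = i + 2 * d + 1` with `2 * d + 1 < n`: if `(i, j)`
is necessary and `τ(i, j) ≤ 2π/3`, then try all `k` among the `n - (2 * d + 2)` vertices
`j + 1, …, i - 1` with `(j + 1, k)` feasible, that is, `k = j + 1 + (2 * e + 1)`. -/
def threeCascades : Cmd :=
  .forLoop .i n (.forLoop .d (n / 2) (.block [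
    .setInt .j (fwd i (2 * d + 1)),
    turningAngle,
    .ite (.and (.get .necessary i j) (.le (.var .theta) (2 * .pi / 3)))
      (.forLoop .e ((n - (2 * d + 2)) / 2) (.block [
        .setInt .k (fwd (j + 1) (2 * e + 1)),
        .setReal .best (.min (.var .best)
          (.max (tab i j) (.max (tab (fwd j 1) k) (tab (fwd k 1) (bwd i 1)))))]))
      .skip]))

/-- The whole algorithm; it leaves its output in the register `best`. -/
def bottleneckMatching : Cmd :=
  .block [initTable, fillTable, oneCascade, threeCascades]

end Algorithm

/-- The state `s` holds the input: the number `n` and the coordinates of the points.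
All other registers and array entries are arbitrary. -/
structure IsInput {n : ℕ} (v : Fin n → Plane) (s : State) : Prop where
  size : s.int .n = n
  xcoord : ∀ i : Fin n, s.arr (.coord, (i : ℕ), 0) = v i 0
  ycoord : ∀ i : Fin n, s.arr (.coord, (i : ℕ), 1) = v i 1

end Bottleneck

end

noncomputable section

namespace Bottleneck

/-! The vertices are extended to a sequence `V` of period `n`, so that every cyclic interval becomes
an interval of natural numbers, and the edges get increasing directions `θ` with `θ (k + n) = θ k +
2π`. The turn of a chain is the difference of the directions of its last and first edges. An
interval is called solved (`Good`) for a bound `l` if the recurrence can match it without exceeding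
`l`; this is the same as its table entry being at most `l` (`Good.table_le`, `good_of_table_le`).

Every value that the algorithm takes for `best` bounds the segments of some matching, so `best` is
never too small. For the converse, let a matching have all lengths at most `l`. A solved interval
turning by at most `π/2` can be matched by polygon edges, because in such a chain no edge is longer
than the chord (`Good.edges_or_turn`). Edges are absorbed by neighbouring intervals, so a run of
solved intervals is either made of edges or consists of pieces turning by more than `π/2` each. Take
a segment that does not bound a solved interval, minimal in the sense that all segments inside it
do. Inside it lie at least two pieces, which turn by more than `π` in total. The other side of the
polygon has no room for a second such segment, hence it is solved as a whole. So the entire polygon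
decomposes (`IsPartner.exists_decomposes`), and as the total turn is below `2π`, there are at most
three pieces. One or two pieces can be rearranged into one solved interval; of three pieces, one
turns by at most `2π/3` and can be trimmed to a necessary pair (`IsPartner.exists_solution`).

The running time depends on the number of candidates, that is, necessary pairs turning by at most
`2π/3`. If such a pair is not an edge, its chain has exactly one edge longer than its chord, and
then the chord makes an angle of at least `π/3` with the first or the last edge. In the first case
no longer candidate starts at the same vertex, in the second none ends at the same vertex. So there
are at most `3n` candidates (`sum_isCandidate_le`), and each costs `O(n)` steps. -/

/-! ## The periodic sequence of vertices -/

/-- `V` is the `n`-periodic sequence of the vertices of a convex polygon. -/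
structure ConvexLift (n : ℕ) (V : ℕ → Plane) : Prop where
  two_le : 2 ≤ n
  periodic : ∀ k, V (k + n) = V k
  orient_pos : ∀ {x y z : ℕ}, x < y → y < z → z < x + n → 0 < orient (V x) (V y) (V z)
  ne : ∀ {x y : ℕ}, x < y → y < x + n → V x ≠ V y

theorem orient_rotate (p q r : Plane) : orient q r p = orient p q r := by
  unfold orient; ring

theorem mod_add_cases {n x u : ℕ} (hn : 0 < n) (hu : u < n) :
    ((x + u) % n = x % n + u ∧ x % n + u < n) ∨ ((x + u) % n + n = x % n + u) := by
  have hx := Nat.mod_lt x hn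
  rw [Nat.add_mod, Nat.mod_eq_of_lt hu]
  by_cases h : x % n + u < n
  · exact Or.inl ⟨Nat.mod_eq_of_lt h, h⟩
  · right
    rw [Nat.mod_eq_sub_mod (by omega), Nat.mod_eq_of_lt (by omega)]
    omega

/-- The periodic sequence of vertices determined by `v`. -/
def lift {n : ℕ} (hn : 0 < n) (v : Fin n → Plane) (k : ℕ) : Plane := v ⟨k % n, Nat.mod_lt k hn⟩

theorem IsConvexCCW.convexLift {n : ℕ} (hn : 2 ≤ n) {v : Fin n → Plane} (hv : IsConvexCCW v) :
    ConvexLift n (lift (by omega) v) := by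
  have h0 : 0 < n := by omega
  refine ⟨hn, fun k => by simp [lift], ?_, ?_⟩
  · intro x y z hxy hyz hzx
    obtain ⟨u, rfl⟩ := Nat.exists_eq_add_of_lt hxy
    obtain ⟨w, rfl⟩ := Nat.exists_eq_add_of_lt hyz
    have hx := Nat.mod_lt x h0
    have e1 : x + u + 1 = x + (u + 1) := by ring
    have e2 : x + u + 1 + w + 1 = x + (u + w + 2) := by ring
    rw [e2, e1]
    unfold lift
    -- The three indices span less than one period, so reduction modulo `n` only permutes the triple
    -- cyclically, which leaves `orient` unchanged. A wrap-around of the middle index alone is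
    -- impossible.
    rcases mod_add_cases (x := x) h0 (show u + 1 < n by omega) with h1 | h1 <;>
      rcases mod_add_cases (x := x) h0 (show u + w + 2 < n by omega) with h2 | h2
    · exact hv.ccw _ _ _ (by simp only [Fin.mk_lt_mk]; omega) (by simp only [Fin.mk_lt_mk]; omega)
    · rw [orient_rotate]
      exact hv.ccw _ _ _ (by simp only [Fin.mk_lt_mk]; omega) (by simp only [Fin.mk_lt_mk]; omega)
    · omega
    · rw [← orient_rotate]
      exact hv.ccw _ _ _ (by simp only [Fin.mk_lt_mk]; omega) (by simp only [Fin.mk_lt_mk]; omega)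
  · intro x y hxy hyx h
    obtain ⟨u, rfl⟩ := Nat.exists_eq_add_of_lt hxy
    have e1 : x + u + 1 = x + (u + 1) := by ring
    have h2 := hv.convexIndependent.injective h
    simp only [Fin.mk.injEq] at h2
    rw [e1] at h2
    rcases mod_add_cases (x := x) h0 (show u + 1 < n by omega) with h1 | h1 <;> omega

/-! ## Crossing segments -/

/-- The common point is explicit: the weights on the two diagonals of a convex quadrilateral are
ratios of triangle areas, with equal total areas as denominators. -/
theorem not_disjoint_segment {a b c d : Plane} (h₁ : 0 < orient a b c) (h₂ : 0 < orient a b d)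
    (h₃ : 0 < orient a c d) (h₄ : 0 < orient b c d) :
    ¬ Disjoint (segment ℝ a c) (segment ℝ b d) := by
  have hT : orient b c d + orient a b d = orient a c d + orient a b c := by unfold orient; ring
  have hpos : 0 < orient b c d + orient a b d := by positivity
  have hpos' : 0 < orient a c d + orient a b c := by positivity
  rw [Set.not_disjoint_iff]
  refine ⟨(orient b c d / (orient b c d + orient a b d)) • a +
    (orient a b d / (orient b c d + orient a b d)) • c,
    ⟨_, _, by positivity, by positivity, by field_simp, rfl⟩,
    ⟨orient a c d / (orient a c d + orient a b c), orient a b c / (orient a c d + orient a b c),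
      by positivity, by positivity, by field_simp, ?_⟩⟩
  rw [← hT]
  ext t
  simp only [PiLp.add_apply, PiLp.smul_apply, smul_eq_mul]
  field_simp
  fin_cases t <;> simp [orient] <;> ring

/-- Both `c` and `d` lie strictly to the left of the line through `a` and `b`, hence so does their
segment. -/
theorem disjoint_segment {a b c d : Plane} (h₁ : 0 < orient a b c) (h₂ : 0 < orient a b d) :
    Disjoint (segment ℝ a b) (segment ℝ c d) := by
  rw [Set.disjoint_left]
  rintro p ⟨s, t, hs, ht, hst, rfl⟩ ⟨s', t', hs', ht', hst', h⟩
  have h0 := congrArg (fun q : Plane => q 0) h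
  have h1 := congrArg (fun q : Plane => q 1) h
  simp only [PiLp.add_apply, PiLp.smul_apply, smul_eq_mul] at h0 h1
  have key : s' * orient a b c + t' * orient a b d = 0 := by
    obtain rfl : s = 1 - t := by linarith
    obtain rfl : s' = 1 - t' := by linarith
    unfold orient
    linear_combination (b 0 - a 0) * h1 - (b 1 - a 1) * h0
  have : 0 < s' ∨ 0 < t' := by
    by_contra hc
    push Not at hc
    linarith
  rcases this with h | h
  · have := mul_pos h h₁
    have := mul_nonneg ht' h₂.le
    linarith
  · have := mul_pos h h₂
    have := mul_nonneg hs' h₁.le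
    linarith

namespace ConvexLift

variable {n : ℕ} {V : ℕ → Plane}

theorem segment_cross (hV : ConvexLift n V) {a b c d : ℕ} (hab : a < b) (hbc : b < c) (hcd : c < d)
    (hda : d < a + n) : ¬ Disjoint (segment ℝ (V a) (V c)) (segment ℝ (V b) (V d)) :=
  not_disjoint_segment (hV.orient_pos hab hbc (by omega)) (hV.orient_pos hab (by omega) hda)
    (hV.orient_pos (by omega) hcd hda) (hV.orient_pos hbc hcd (by omega))

theorem segment_side (hV : ConvexLift n V) {a b c d : ℕ} (hab : a < b) (hbc : b < c) (hbd : b < d)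
    (hca : c < a + n) (hda : d < a + n) :
    Disjoint (segment ℝ (V a) (V b)) (segment ℝ (V c) (V d)) :=
  disjoint_segment (hV.orient_pos hab hbc hca) (hV.orient_pos hab hbd hda)

theorem segment_nest (hV : ConvexLift n V) {a b c d : ℕ} (hab : a < b) (hac : a < c) (hbd : b < d)
    (hcd : c < d) (hda : d < a + n) :
    Disjoint (segment ℝ (V a) (V d)) (segment ℝ (V b) (V c)) := by
  rw [segment_symm ℝ (V a) (V d)]
  refine disjoint_segment ?_ ?_
  · rw [← orient_rotate]; exact hV.orient_pos hab hbd hda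
  · rw [← orient_rotate]; exact hV.orient_pos hac hcd hda

end ConvexLift

/-! ## Directions of the edges -/

/-- `r k` and `θ k` are the length and the direction of the edge from `V k` to `V (k + 1)`, where
the directions increase and make one full turn in a period. -/
structure Directions (n : ℕ) (V : ℕ → Plane) (r θ : ℕ → ℝ) : Prop where
  pos : ∀ k, 0 < r k
  strictMono : StrictMono θ
  add_period : ∀ k, θ (k + n) = θ k + 2 * Real.pi
  xstep : ∀ k, V (k + 1) 0 - V k 0 = r k * Real.cos (θ k)
  ystep : ∀ k, V (k + 1) 1 - V k 1 = r k * Real.sin (θ k)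

theorem dist_eq_sqrt (p q : Plane) :
    dist p q = √((p 0 - q 0) * (p 0 - q 0) + (p 1 - q 1) * (p 1 - q 1)) := by
  rw [EuclideanSpace.dist_eq]
  simp [Real.dist_eq, Fin.sum_univ_two, sq]

theorem exists_polar {p q : Plane} (φ : ℝ) :
    ∃ β, φ ≤ β ∧ β < φ + 2 * Real.pi ∧ q 0 - p 0 = dist p q * Real.cos β ∧
      q 1 - p 1 = dist p q * Real.sin β := by
  have hd : dist p q = ‖(⟨q 0 - p 0, q 1 - p 1⟩ : ℂ)‖ := by
    rw [dist_comm, dist_eq_sqrt, Complex.norm_def, Complex.normSq_mk]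
  refine ⟨toIcoMod Real.two_pi_pos φ (Complex.arg ⟨q 0 - p 0, q 1 - p 1⟩),
    left_le_toIcoMod _ _ _, toIcoMod_lt_right _ _ _, ?_, ?_⟩
  · rw [toIcoMod, zsmul_eq_mul, Real.cos_sub_int_mul_two_pi, hd, Complex.norm_mul_cos_arg]
  · rw [toIcoMod, zsmul_eq_mul, Real.sin_sub_int_mul_two_pi, hd, Complex.norm_mul_sin_arg]

/-- Left turns alone would allow a closed polygon winding around several times. Orientations of
triples containing `V 0` exclude this: measured from the first edge, the directions cannot pass `2π`
before the period ends. -/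
theorem ConvexLift.exists_directions {n : ℕ} {V : ℕ → Plane} (hV : ConvexLift n V) :
    ∃ θ, Directions n V (fun k => dist (V k) (V (k + 1))) θ := by
  have h2 := hV.two_le
  have h0 : 0 < n := by omega
  set r : ℕ → ℝ := fun k => dist (V k) (V (k + 1)) with hr
  have hpos : ∀ k, 0 < r k := fun k => dist_pos.2 (hV.ne (by omega) (by omega))
  obtain ⟨φ, -, -, hφx, hφy⟩ := exists_polar (p := V 0) (q := V 1) 0
  have hex : ∀ k, ∃ β, φ ≤ β ∧ β < φ + 2 * Real.pi ∧ V (k + 1) 0 - V k 0 = r k * Real.cos β ∧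
      V (k + 1) 1 - V k 1 = r k * Real.sin β ∧ (k = 0 → β = φ) := by
    intro k
    rcases Nat.eq_zero_or_pos k with rfl | hk
    · exact ⟨φ, le_rfl, by linarith [Real.pi_pos], hφx, hφy, fun _ => rfl⟩
    · obtain ⟨β, h1, h2, h3, h4⟩ := exists_polar (p := V k) (q := V (k + 1)) φ
      exact ⟨β, h1, h2, h3, h4, fun h => by omega⟩
  choose β hβl hβr hβx hβy hβ0 using hex
  have hβ0 : β 0 = φ := hβ0 0 rfl
  have hcross : ∀ k l, (V (k + 1) 0 - V k 0) * (V (l + 1) 1 - V l 1) -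
      (V (k + 1) 1 - V k 1) * (V (l + 1) 0 - V l 0) = r k * r l * Real.sin (β l - β k) := by
    intro k l
    rw [hβx, hβy, hβx, hβy, Real.sin_sub]; ring
  have hV0 : V n = V 0 := by simpa using hV.periodic 0
  -- the relative directions increase up to the last edge
  have hlt : ∀ t, t + 1 < n → β t < β (t + 1) := by
    intro t ht
    by_contra hle
    push Not at hle
    rcases Nat.eq_zero_or_pos t with rfl | htpos
    · have hβ1 : β 1 = φ := le_antisymm (by rw [← hβ0]; simpa using hle) (hβl 1)
      rcases Nat.lt_or_ge 2 n with hn | hn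
      · have h3 := hV.orient_pos (x := 0) (y := 1) (z := 2) (by omega) (by omega) (by omega)
        have h4 := hcross 0 1
        simp only [hβ0, hβ1, sub_self, Real.sin_zero, mul_zero, zero_add] at h4
        unfold orient at h3
        norm_num at h4
        nlinarith
      · obtain rfl : n = 2 := by omega
        have hx0 := hβx 0
        have hx1 := hβx 1
        have hy0 := hβy 0
        have hy1 := hβy 1
        have hp0 := hpos 0
        have hp1 := hpos 1
        norm_num [hβ0, hβ1, hV0] at hx0 hx1 hy0 hy1
        have e1 : (r 0 + r 1) * Real.cos φ = 0 := by linarith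
        have e2 : (r 0 + r 1) * Real.sin φ = 0 := by linarith
        have hne : r 0 + r 1 ≠ 0 := by positivity
        have c0 := (mul_eq_zero.1 e1).resolve_left hne
        have s0 := (mul_eq_zero.1 e2).resolve_left hne
        have := Real.sin_sq_add_cos_sq φ
        rw [c0, s0] at this
        norm_num at this
    · have h3 : 0 < Real.sin (β (t + 1) - β t) := by
        have h4 := hcross t (t + 1)
        have h5 := hV.orient_pos (x := t) (y := t + 1) (z := t + 1 + 1) (by omega) (by omega)
          (by omega)
        have h6 : 0 < r t * r (t + 1) * Real.sin (β (t + 1) - β t) := by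
          rw [← h4]; unfold orient at h5; nlinarith
        exact pos_of_mul_pos_right h6 (mul_pos (hpos _) (hpos _)).le
      -- A left turn that lowers the normalized direction has jumped over `φ + 2π`, so the drop
      -- exceeds `π`. Hence, relative to the first edge, edge `t` points weakly to the right and
      -- edge `t + 1` weakly to the left.
      have hgap : β (t + 1) - β t < -Real.pi := by
        by_contra hc
        push Not at hc
        exact absurd (Real.sin_nonpos_of_nonpos_of_neg_pi_le (by linarith) hc) (by linarith)
      have hA := hβl (t + 1)
      have hB := hβr t
      have hs1 : Real.sin (β t - β 0) ≤ 0 := by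
        have : Real.sin (β t - β 0) = - Real.sin (β t - β 0 - Real.pi) := by
          rw [Real.sin_sub_pi, neg_neg]
        rw [this, neg_nonpos]
        exact Real.sin_nonneg_of_nonneg_of_le_pi (by linarith) (by linarith)
      have hs2 : 0 ≤ Real.sin (β (t + 1) - β 0) :=
        Real.sin_nonneg_of_nonneg_of_le_pi (by linarith) (by linarith)
      have c0 := hcross t (t + 1)
      have c1 := hcross 0 t
      have c2 := hcross 0 (t + 1)
      have cp0 := mul_pos (mul_pos (hpos t) (hpos (t + 1))) h3
      have cp1 := mul_nonneg (mul_pos (hpos 0) (hpos (t + 1))).le hs2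
      have cp2 : r 0 * r t * Real.sin (β t - β 0) ≤ 0 :=
        mul_nonpos_of_nonneg_of_nonpos (mul_pos (hpos 0) (hpos t)).le hs1
      rw [← c0] at cp0
      rw [← c2] at cp1
      rw [← c1] at cp2
      have d0 := hV.orient_pos (x := 0) (y := 1) (z := t + 1) (by omega) (by omega) (by omega)
      have d1 := hV.orient_pos (x := t) (y := t + 1) (z := n) (by omega) (by omega) (by omega)
      have d2 : 0 ≤ orient (V (t + 1)) (V (t + 1 + 1)) (V n) := by
        rcases Nat.lt_or_ge (t + 1 + 1) n with h | h
        · exact (hV.orient_pos (by omega) h (by omega)).le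
        · have : t + 1 + 1 = n := by omega
          rw [this]; unfold orient; nlinarith
      rw [hV0] at d1 d2
      set a := V t
      set b := V (t + 1)
      set c := V (t + 1 + 1)
      set p := V 0
      set q := V (0 + 1)
      -- By the Plücker relation for the two consecutive edges, the first edge and the vector from
      -- `p` to `b`, the left-hand sides of `e1`, `e2` and `e3` add up to zero, although the first
      -- is positive and the others are nonnegative.
      have e1 := mul_pos cp0 d0
      have e2 := mul_nonneg d1.le cp1
      have e3 := mul_nonneg d2 (neg_nonneg.2 cp2)
      unfold orient at *
      nlinarith
  refine ⟨fun k => β (k % n) + 2 * Real.pi * (k / n : ℕ), hpos, ?_, ?_, ?_, ?_⟩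
  · refine strictMono_nat_of_lt_succ fun k => ?_
    have hk := Nat.mod_lt k h0
    rcases mod_add_cases (x := k) h0 (show 1 < n by omega) with ⟨h, h'⟩ | h
    · have hdiv : (k + 1) / n = k / n := by
        have a1 := Nat.div_add_mod (k + 1) n
        have a2 := Nat.div_add_mod k n
        have : n * ((k + 1) / n) = n * (k / n) := by omega
        exact Nat.eq_of_mul_eq_mul_left h0 this
      simp only [h, hdiv]
      linarith [hlt (k % n) h']
    · have hdiv : (k + 1) / n = k / n + 1 := by
        have a1 := Nat.div_add_mod (k + 1) n
        have a2 := Nat.div_add_mod k n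
        have : n * ((k + 1) / n) = n * (k / n + 1) := by rw [mul_add]; omega
        exact Nat.eq_of_mul_eq_mul_left h0 this
      simp only [hdiv]
      push_cast
      nlinarith [hβl ((k + 1) % n), hβr (k % n)]
  · intro k
    simp only [Nat.add_mod_right, Nat.add_div_right k h0]
    push_cast; ring
  all_goals
    intro k
    have hper : ∀ m k, V (k + n * m) = V k := by
      intro m
      induction m with
      | zero => simp
      | succ m ih => intro k; rw [mul_add, mul_one, ← add_assoc, hV.periodic, ih]
    have e1 : V k = V (k % n) := by
      conv_lhs => rw [← Nat.mod_add_div k n]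
      exact hper _ _
    have e2 : V (k + 1) = V (k % n + 1) := by
      conv_lhs => rw [← Nat.mod_add_div k n, add_right_comm]
      exact hper _ _
    have e3 : 2 * Real.pi * ((k / n : ℕ) : ℝ) = ((k / n : ℕ) : ℝ) * (2 * Real.pi) := by ring
    have e4 : r k = r (k % n) := by simp only [hr]; rw [e1, e2]
    simp only [e3, Real.cos_add_nat_mul_two_pi, Real.sin_add_nat_mul_two_pi, e1, e2]
    rw [e4]
    first | exact hβx _ | exact hβy _

/-! ## Projections of chains -/

namespace Directions

variable {n : ℕ} {V : ℕ → Plane} {r θ : ℕ → ℝ}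

theorem proj (h : Directions n V r θ) (η : ℝ) {i j : ℕ} (hij : i ≤ j) :
    (V j 0 - V i 0) * Real.cos η + (V j 1 - V i 1) * Real.sin η =
      ∑ q ∈ Finset.Ico i j, r q * Real.cos (θ q - η) := by
  induction j, hij using Nat.le_induction with
  | base => simp
  | succ j hij ih =>
    rw [Finset.sum_Ico_succ_top hij, ← ih, Real.cos_sub]
    linear_combination Real.cos η * h.xstep j + Real.sin η * h.ystep j

theorem proj_le_dist (p q : Plane) (η : ℝ) :
    (q 0 - p 0) * Real.cos η + (q 1 - p 1) * Real.sin η ≤ dist p q := by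
  rw [dist_comm, dist_eq_sqrt]
  apply Real.le_sqrt_of_sq_le
  have := Real.sin_sq_add_cos_sq η
  nlinarith [sq_nonneg ((q 0 - p 0) * Real.sin η - (q 1 - p 1) * Real.cos η)]

theorem sum_cos_le_dist (h : Directions n V r θ) (η : ℝ) {i j : ℕ} (hij : i ≤ j) :
    ∑ q ∈ Finset.Ico i j, r q * Real.cos (θ q - η) ≤ dist (V i) (V j) := by
  rw [← h.proj η hij]; exact proj_le_dist _ _ _

theorem dist_succ (h : Directions n V r θ) (k : ℕ) : dist (V k) (V (k + 1)) = r k := by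
  have hx := h.xstep k
  have hy := h.ystep k
  rw [dist_comm, dist_eq_sqrt, hx, hy]
  have : r k * Real.cos (θ k) * (r k * Real.cos (θ k)) +
      r k * Real.sin (θ k) * (r k * Real.sin (θ k)) = r k ^ 2 := by
    linear_combination r k ^ 2 * Real.sin_sq_add_cos_sq (θ k)
  rw [this, Real.sqrt_sq (h.pos k).le]

/-- The contribution of one edge to the projection on a direction that makes no obtuse angle with
any edge. -/
theorem single_le_sum (h : Directions n V r θ) {η : ℝ} {i j p : ℕ} (hp : p ∈ Finset.Ico i j)
    (hη : ∀ q ∈ Finset.Ico i j, |θ q - η| ≤ Real.pi / 2) :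
    r p * Real.cos (θ p - η) ≤ ∑ q ∈ Finset.Ico i j, r q * Real.cos (θ q - η) :=
  Finset.single_le_sum (f := fun q => r q * Real.cos (θ q - η))
    (fun q hq => mul_nonneg (h.pos q).le
      (Real.cos_nonneg_of_neg_pi_div_two_le_of_le (abs_le.1 (hη q hq)).1 (abs_le.1 (hη q hq)).2)) hp

theorem mono_bounds (h : Directions n V r θ) {i j q : ℕ} (hq : q ∈ Finset.Ico i (j + 1)) :
    θ i ≤ θ q ∧ θ q ≤ θ j := by
  rw [Finset.mem_Ico] at hq
  exact ⟨h.strictMono.monotone hq.1, h.strictMono.monotone (by omega)⟩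

/-- Project the chain on the direction of the edge `p`: no edge contributes negatively and the edge
`p` contributes its full length. -/
theorem edge_le_dist (h : Directions n V r θ) {i j p : ℕ} (hij : θ j - θ i ≤ Real.pi / 2)
    (hp : p ∈ Finset.Ico i (j + 1)) : r p ≤ dist (V i) (V (j + 1)) := by
  have hp' := h.mono_bounds hp
  have h1 := h.single_le_sum (η := θ p) hp fun q hq => by
    have := h.mono_bounds hq
    rw [abs_le]; constructor <;> linarith
  have h2 := h.sum_cos_le_dist (θ p) (i := i) (j := j + 1) (by rw [Finset.mem_Ico] at hp; omega)
  rw [sub_self, Real.cos_zero, mul_one] at h1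
  linarith

/-- In a chain that turns by at most `2π/3`, at most one edge is longer than the chord. -/
theorem eq_of_dist_lt (h : Directions n V r θ) {i j p q : ℕ} (hij : θ j - θ i ≤ 2 * Real.pi / 3)
    (hp : p ∈ Finset.Ico i (j + 1)) (hq : q ∈ Finset.Ico i (j + 1))
    (hpd : dist (V i) (V (j + 1)) < r p) (hqd : dist (V i) (V (j + 1)) < r q) : p = q := by
  by_contra hne
  -- Every edge makes an angle of at most `π/3` with this bisector, so it contributes at least half
  -- of its length to the projection. Two edges longer than the chord would project to more than the
  -- chord.
  set η := (θ i + θ j) / 2 with hη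
  have hcos : ∀ x ∈ Finset.Ico i (j + 1), 1 / 2 ≤ Real.cos (θ x - η) := by
    intro x hx
    have := h.mono_bounds hx
    rw [← Real.cos_abs, ← Real.cos_pi_div_three]
    apply Real.cos_le_cos_of_nonneg_of_le_pi (abs_nonneg _) (by linarith [Real.pi_pos])
    rw [abs_le]; constructor <;> linarith
  have h1 : ∑ x ∈ ({p, q} : Finset ℕ), r x * Real.cos (θ x - η) ≤
      ∑ x ∈ Finset.Ico i (j + 1), r x * Real.cos (θ x - η) := by
    apply Finset.sum_le_sum_of_subset_of_nonneg
    · intro x hx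
      rcases Finset.mem_insert.1 hx with rfl | hx
      · exact hp
      · rwa [Finset.mem_singleton.1 hx]
    · intro x hx _
      exact mul_nonneg (h.pos x).le (by linarith [hcos x hx])
  rw [Finset.sum_pair hne] at h1
  have h2 := h.sum_cos_le_dist η (i := i) (j := j + 1) (by rw [Finset.mem_Ico] at hp; omega)
  have h3 := mul_le_mul_of_nonneg_left (hcos p hp) (h.pos p).le
  have h4 := mul_le_mul_of_nonneg_left (hcos q hq) (h.pos q).le
  linarith

/-- `D` is the direction of the chord from `V i` to `V j`. -/
def IsChordDirection (V : ℕ → Plane) (i j : ℕ) (D : ℝ) : Prop :=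
  V j 0 - V i 0 = dist (V i) (V j) * Real.cos D ∧ V j 1 - V i 1 = dist (V i) (V j) * Real.sin D

theorem IsChordDirection.proj {i j : ℕ} {D : ℝ} (hD : IsChordDirection V i j D)
    (η : ℝ) :
    (V j 0 - V i 0) * Real.cos η + (V j 1 - V i 1) * Real.sin η =
      dist (V i) (V j) * Real.cos (D - η) := by
  rw [hD.1, hD.2, Real.cos_sub]; ring

/-- The perpendiculars `θ i + π/2` and `θ j - π/2` make no obtuse angle with any edge, so the chord
projects positively on both. This gives the signs of `sin (D - θ i)` and `sin (θ j - D)`, which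
place `D` between the extreme directions. -/
theorem exists_chordDirection (h : Directions n V r θ) {i j : ℕ} (hij : i < j)
    (hlt : θ j - θ i < Real.pi) :
    ∃ D, IsChordDirection V i (j + 1) D ∧ θ i ≤ D ∧ D ≤ θ j := by
  obtain ⟨D, h1, h2, h3, h4⟩ := exists_polar (p := V i) (q := V (j + 1)) (θ i)
  have hD : IsChordDirection V i (j + 1) D := ⟨h3, h4⟩
  have hij' : i ≤ j + 1 := by omega
  have hw := h.strictMono hij
  have key : ∀ ρ, 0 ≤ Real.pi / 2 - (θ j - ρ) → θ i - ρ ≥ - (Real.pi / 2) →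
      0 < dist (V i) (V (j + 1)) * Real.cos (D - ρ) ∨
        (∀ q ∈ Finset.Ico i (j + 1), Real.cos (θ q - ρ) = 0) := by
    intro ρ hρ1 hρ2
    rw [← hD.proj ρ, h.proj ρ hij']
    have hnn : ∀ q ∈ Finset.Ico i (j + 1), 0 ≤ r q * Real.cos (θ q - ρ) := fun q hq => by
      have := h.mono_bounds hq
      exact mul_nonneg (h.pos q).le
        (Real.cos_nonneg_of_neg_pi_div_two_le_of_le (by linarith) (by linarith))
    rcases (Finset.sum_nonneg hnn).lt_or_eq with hlt | heq
    · exact Or.inl hlt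
    · right
      intro q hq
      have := (Finset.sum_eq_zero_iff_of_nonneg hnn).1 heq.symm q hq
      exact (mul_eq_zero.1 this).resolve_left (h.pos q).ne'
  have hi : i ∈ Finset.Ico i (j + 1) := Finset.mem_Ico.2 ⟨le_rfl, by omega⟩
  have hj : j ∈ Finset.Ico i (j + 1) := Finset.mem_Ico.2 ⟨by omega, by omega⟩
  have hπ := Real.pi_pos
  have hA : 0 < Real.sin (D - θ i) := by
    rcases key (θ i + Real.pi / 2) (by linarith) (by linarith) with hk | hk
    · rw [← sub_sub, Real.cos_sub_pi_div_two] at hk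
      exact pos_of_mul_pos_right hk dist_nonneg
    · have := hk j hj
      rw [← sub_sub, Real.cos_sub_pi_div_two] at this
      exact absurd this (Real.sin_pos_of_pos_of_lt_pi (by linarith) hlt).ne'
  have hB : 0 < Real.sin (θ j - D) := by
    rcases key (θ j - Real.pi / 2) (by linarith) (by linarith) with hk | hk
    · rw [show D - (θ j - Real.pi / 2) = Real.pi / 2 - (θ j - D) by ring,
        Real.cos_pi_div_two_sub] at hk
      exact pos_of_mul_pos_right hk dist_nonneg
    · have := hk i hi
      rw [show θ i - (θ j - Real.pi / 2) = Real.pi / 2 - (θ j - θ i) by ring,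
        Real.cos_pi_div_two_sub] at this
      exact absurd this (Real.sin_pos_of_pos_of_lt_pi (by linarith) hlt).ne'
  refine ⟨D, hD, h1, ?_⟩
  by_contra hc
  push Not at hc
  have hDπ : D - θ i < Real.pi := by
    by_contra hge
    push Not at hge
    have : Real.sin (D - θ i) = - Real.sin (D - θ i - Real.pi) := by
      rw [Real.sin_sub_pi, neg_neg]
    have h5 := Real.sin_nonneg_of_nonneg_of_le_pi (x := D - θ i - Real.pi) (by linarith)
      (by linarith)
    linarith
  have := Real.sin_nonpos_of_nonpos_of_neg_pi_le (x := θ j - D) (by linarith) (by linarith)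
  linarith

/-- If the chord makes angles less than `π/3` with the first and the last edge, then no edge is
longer than the chord. -/
theorem edge_le_of_chordDirection (h : Directions n V r θ) {i j p : ℕ} {D : ℝ}
    (hD : IsChordDirection V i (j + 1) D) (h1 : D - θ i < Real.pi / 3)
    (h2 : θ j - D < Real.pi / 3) (hp : p ∈ Finset.Ico i (j + 1)) :
    r p ≤ dist (V i) (V (j + 1)) := by
  have hij : i ≤ j + 1 := by rw [Finset.mem_Ico] at hp; omega
  have hpb := h.mono_bounds hp
  have hπ := Real.pi_pos
  have hc : 0 < Real.cos (Real.pi / 6) := Real.cos_pos_of_mem_Ioo ⟨by linarith, by linarith⟩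
  -- Choose `η` at the angle `π/6` from the chord, on the side of the edge `p`. It is then within
  -- `π/6` of that edge and within `π/2` of all the others, so the projection compares `r p` and the
  -- chord with the same factor `cos (π/6)`.
  have key : ∀ η, |θ p - η| ≤ Real.pi / 6 → |D - η| = Real.pi / 6 →
      r p ≤ dist (V i) (V (j + 1)) := by
    intro η hη1 hη2
    have h3 := h.single_le_sum (η := η) hp fun q hq => by
      have := h.mono_bounds hq
      have := abs_le.1 hη2.le
      rw [abs_le]; constructor <;> linarith
    rw [← h.proj η hij, hD.proj η, ← Real.cos_abs (D - η), hη2] at h3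
    have h4 : Real.cos (Real.pi / 6) ≤ Real.cos (θ p - η) := by
      rw [← Real.cos_abs (θ p - η)]
      exact Real.cos_le_cos_of_nonneg_of_le_pi (abs_nonneg _) (by linarith) hη1
    have h5 := mul_le_mul_of_nonneg_left h4 (h.pos p).le
    exact le_of_mul_le_mul_right (h5.trans h3) hc
  rcases le_total D (θ p) with hle | hle
  · refine key (D + Real.pi / 6) (by rw [abs_le]; constructor <;> linarith) ?_
    rw [show D - (D + Real.pi / 6) = -(Real.pi / 6) by ring, abs_neg, abs_of_pos (by linarith)]
  · refine key (D - Real.pi / 6) (by rw [abs_le]; constructor <;> linarith) ?_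
    rw [show D - (D - Real.pi / 6) = Real.pi / 6 by ring, abs_of_pos (by linarith)]

/-- Prolonging a chain at its end. -/
theorem prolong_right (h : Directions n V r θ) {i j k : ℕ} {D : ℝ} (hij : i ≤ j) (hjk : j ≤ k)
    (hD : IsChordDirection V i (j + 1) D) (hDj : D ≤ θ j) (hDk : θ k - D ≤ Real.pi / 3) :
    (j < k → dist (V i) (V (j + 1)) < dist (V i) (V (k + 1))) ∧
      ∀ p ∈ Finset.Ico (j + 1) (k + 1), r p ≤ dist (V i) (V (k + 1)) := by
  have hπ := Real.pi_pos
  have hb : ∀ q ∈ Finset.Ico (j + 1) (k + 1), D ≤ θ q ∧ θ q ≤ θ k := fun q hq => by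
    have := h.mono_bounds hq
    exact ⟨hDj.trans ((h.strictMono.monotone (by omega)).trans this.1), this.2⟩
  -- The first part of the chain is replaced by its chord, as if it were a single edge of direction
  -- `D`. Projecting on `D` compares the two chords; projecting on `θ p` compares an added edge with
  -- the new chord.
  have split : ∀ η, dist (V i) (V (j + 1)) * Real.cos (D - η) +
      ∑ q ∈ Finset.Ico (j + 1) (k + 1), r q * Real.cos (θ q - η) ≤ dist (V i) (V (k + 1)) := by
    intro η
    rw [← hD.proj η, h.proj η (by omega), Finset.sum_Ico_consecutive _ (by omega) (by omega)]
    exact h.sum_cos_le_dist η (by omega)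
  constructor
  · intro hlt
    have h1 := split D
    rw [sub_self, Real.cos_zero, mul_one] at h1
    have h2 : 0 < ∑ q ∈ Finset.Ico (j + 1) (k + 1), r q * Real.cos (θ q - D) := by
      apply Finset.sum_pos
      · intro q hq
        have := hb q hq
        exact mul_pos (h.pos q) (Real.cos_pos_of_mem_Ioo ⟨by linarith, by linarith⟩)
      · exact ⟨j + 1, Finset.mem_Ico.2 ⟨le_rfl, by omega⟩⟩
    linarith
  · intro p hp
    have h1 := split (θ p)
    have hpb := hb p hp
    have h2 := h.single_le_sum (η := θ p) hp fun q hq => by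
      have := hb q hq
      rw [abs_le]; constructor <;> linarith
    rw [sub_self, Real.cos_zero, mul_one] at h2
    have h3 : 0 ≤ dist (V i) (V (j + 1)) * Real.cos (D - θ p) :=
      mul_nonneg dist_nonneg
        (Real.cos_nonneg_of_neg_pi_div_two_le_of_le (by linarith) (by linarith))
    linarith

/-- Prolonging a chain at its start. -/
theorem prolong_left (h : Directions n V r θ) {i j k : ℕ} {D : ℝ} (hij : i ≤ j) (hjk : j ≤ k)
    (hD : IsChordDirection V j (k + 1) D) (hDj : θ j ≤ D) (hDk : D - θ i ≤ Real.pi / 3) :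
    (i < j → dist (V j) (V (k + 1)) < dist (V i) (V (k + 1))) ∧
      ∀ p ∈ Finset.Ico i j, r p ≤ dist (V i) (V (k + 1)) := by
  have hπ := Real.pi_pos
  have hb : ∀ q ∈ Finset.Ico i j, θ i ≤ θ q ∧ θ q ≤ D := fun q hq => by
    rw [Finset.mem_Ico] at hq
    exact ⟨h.strictMono.monotone hq.1, (h.strictMono.monotone hq.2.le).trans hDj⟩
  have split : ∀ η, ∑ q ∈ Finset.Ico i j, r q * Real.cos (θ q - η) +
      dist (V j) (V (k + 1)) * Real.cos (D - η) ≤ dist (V i) (V (k + 1)) := by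
    intro η
    rw [← hD.proj η, h.proj η (by omega), Finset.sum_Ico_consecutive _ (by omega) (by omega)]
    exact h.sum_cos_le_dist η (by omega)
  constructor
  · intro hlt
    have h1 := split D
    rw [sub_self, Real.cos_zero, mul_one] at h1
    have h2 : 0 < ∑ q ∈ Finset.Ico i j, r q * Real.cos (θ q - D) := by
      apply Finset.sum_pos
      · intro q hq
        have := hb q hq
        exact mul_pos (h.pos q) (Real.cos_pos_of_mem_Ioo ⟨by linarith, by linarith⟩)
      · exact ⟨i, Finset.mem_Ico.2 ⟨le_rfl, by omega⟩⟩
    linarith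
  · intro p hp
    have h1 := split (θ p)
    have hpb := hb p hp
    have h2 := h.single_le_sum (η := θ p) hp fun q hq => by
      have := hb q hq
      rw [abs_le]; constructor <;> linarith
    rw [sub_self, Real.cos_zero, mul_one] at h2
    have h3 : 0 ≤ dist (V j) (V (k + 1)) * Real.cos (D - θ p) :=
      mul_nonneg dist_nonneg
        (Real.cos_nonneg_of_neg_pi_div_two_le_of_le (by linarith) (by linarith))
    linarith

end Directions

/-! ## The table of the algorithm and the intervals it solves -/

/-- `table V d i` is the table entry for the interval `i, …, i + 2 * d + 1`. -/
def table (V : ℕ → Plane) : ℕ → ℕ → ℝ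
  | 0, i => dist (V i) (V (i + 1))
  | d + 1, i =>
    min (max (table V d (i + 1)) (dist (V i) (V (i + 2 * d + 3))))
      (min (max (table V d (i + 2)) (dist (V i) (V (i + 1))))
        (max (table V d i) (dist (V (i + 2 * d + 2)) (V (i + 2 * d + 3)))))

/-- The mark `necessary` for the interval `i, …, i + 2 * d + 1`. -/
def IsNecessary (V : ℕ → Plane) : ℕ → ℕ → Prop
  | 0, _ => True
  | d + 1, i =>
    max (table V d (i + 1)) (dist (V i) (V (i + 2 * d + 3))) <
        max (table V d (i + 2)) (dist (V i) (V (i + 1))) ∧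
      max (table V d (i + 1)) (dist (V i) (V (i + 2 * d + 3))) <
        max (table V d i) (dist (V (i + 2 * d + 2)) (V (i + 2 * d + 3)))

/-- The points `a, …, b - 1` have a matching of the form considered by the recurrence in which no
segment is longer than `l`. -/
inductive Good (V : ℕ → Plane) (l : ℝ) : ℕ → ℕ → Prop
  | empty (a : ℕ) : Good V l a a
  | nest {a b : ℕ} : Good V l (a + 1) b → dist (V a) (V b) ≤ l → Good V l a (b + 1)
  | left {a b : ℕ} : dist (V a) (V (a + 1)) ≤ l → Good V l (a + 2) b → Good V l a b
  | right {a b : ℕ} : Good V l a b → dist (V b) (V (b + 1)) ≤ l → Good V l a (b + 2)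

/-- The points `a, …, b - 1` are matched by edges of the polygon no longer than `l`. -/
def Edges (V : ℕ → Plane) (l : ℝ) (a b : ℕ) : Prop :=
  ∃ d, b = a + 2 * d ∧ ∀ t < d, dist (V (a + 2 * t)) (V (a + 2 * t + 1)) ≤ l

section Intervals

variable {n : ℕ} {V : ℕ → Plane} {l : ℝ} {a b c : ℕ}

theorem Good.exists_eq (h : Good V l a b) : ∃ d, b = a + 2 * d := by
  induction h with
  | empty a => exact ⟨0, rfl⟩
  | nest _ _ ih => obtain ⟨d, hd⟩ := ih; exact ⟨d + 1, by omega⟩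
  | left _ _ ih => obtain ⟨d, hd⟩ := ih; exact ⟨d + 1, by omega⟩
  | right _ _ ih => obtain ⟨d, hd⟩ := ih; exact ⟨d + 1, by omega⟩

/-- The last rule of a derivation selects one of the three cases of the recurrence. Together with
`good_of_table_le`, this makes `Good` the threshold form of the table. -/
theorem Good.table_le (h : Good V l a b) : ∀ d, b = a + 2 * d + 2 → table V d a ≤ l := by
  induction h with
  | empty a => intro d hd; omega
  | @nest a b h1 h2 ih =>
    intro d hd
    cases d with
    | zero => obtain rfl : b = a + 1 := by omega
              exact h2
    | succ d =>
      obtain rfl : b = a + 2 * d + 3 := by omega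
      exact min_le_of_left_le (max_le (ih d (by omega)) h2)
  | @left a b h1 h2 ih =>
    intro d hd
    cases d with
    | zero => exact h1
    | succ d => exact min_le_of_right_le (min_le_of_left_le (max_le (ih d (by omega)) h1))
  | @right a b h1 h2 ih =>
    intro d hd
    cases d with
    | zero => obtain rfl : b = a := by omega
              exact h2
    | succ d =>
      obtain rfl : b = a + 2 * d + 2 := by omega
      exact min_le_of_right_le (min_le_of_right_le (max_le (ih d (by omega)) h2))

theorem good_of_table_le {d : ℕ} (h : table V d a ≤ l) : Good V l a (a + 2 * d + 2) := by
  induction d generalizing a with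
  | zero => exact .right (.empty a) h
  | succ d ih =>
    rw [table, min_le_iff, min_le_iff, max_le_iff, max_le_iff, max_le_iff] at h
    rcases h with h | h | h
    · have := ih h.1
      rw [show a + 1 + 2 * d + 2 = a + 2 * d + 3 by ring] at this
      exact .nest this h.2
    · have := ih h.1
      rw [show a + 2 + 2 * d + 2 = a + 2 * (d + 1) + 2 by ring] at this
      exact .left h.2 this
    · exact .right (ih h.1) h.2

theorem Edges.good_append (h : Edges V l a b) (hb : Good V l b c) : Good V l a c := by
  obtain ⟨d, hd, h⟩ := h
  induction d generalizing a with
  | zero => obtain rfl : b = a := by omega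
            exact hb
  | succ d ih =>
    refine .left (by simpa using h 0 (by omega)) (ih (by omega) fun t ht => ?_)
    have := h (t + 1) (by omega)
    rwa [show a + 2 * (t + 1) = a + 2 + 2 * t by ring] at this

theorem Good.append_edges (h : Good V l a b) (hb : Edges V l b c) : Good V l a c := by
  obtain ⟨d, hd, hb⟩ := hb
  induction d generalizing c with
  | zero => obtain rfl : c = b := by omega
            exact h
  | succ d ih =>
    obtain rfl : c = b + 2 * d + 2 := by omega
    exact .right (ih rfl fun t ht => hb t (by omega)) (hb d (by omega))

theorem Edges.good (h : Edges V l a b) : Good V l a b := h.good_append (.empty b)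

theorem Edges.nil (a : ℕ) : Edges V l a a := ⟨0, rfl, fun t ht => by omega⟩

theorem Edges.single (h : dist (V a) (V (a + 1)) ≤ l) : Edges V l a (a + 2) :=
  ⟨1, rfl, fun t ht => by obtain rfl : t = 0 := by omega
                          exact h⟩

theorem Edges.append (h : Edges V l a b) (h' : Edges V l b c) : Edges V l a c := by
  obtain ⟨d, rfl, h⟩ := h
  obtain ⟨e, rfl, h'⟩ := h'
  refine ⟨d + e, by ring, fun t ht => ?_⟩
  rcases Nat.lt_or_ge t d with htd | htd
  · exact h t htd
  · have := h' (t - d) (by omega)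
    rwa [show a + 2 * d + 2 * (t - d) = a + 2 * t by omega] at this

/-- A solved interval consists of a necessary pair and of edges on both of its sides. -/
theorem Good.exists_necessary (h : Good V l a b) (hab : a < b) :
    ∃ a' d, Edges V l a a' ∧ Edges V l (a' + 2 * d + 2) b ∧ Good V l a' (a' + 2 * d + 2) ∧
      IsNecessary V d a' := by
  obtain ⟨d, rfl⟩ := h.exists_eq
  induction d generalizing a with
  | zero => omega
  | succ d ih =>
    by_cases hN : IsNecessary V d a
    · exact ⟨a, d, .nil a, .nil _, h, hN⟩
    · cases d with
      | zero => exact absurd trivial hN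
      | succ d =>
        have ht := h.table_le (d + 1) (by ring)
        rw [IsNecessary, not_and_or, not_lt, not_lt] at hN
        rw [table] at ht
        -- When the pair is not necessary, the second or the third case of the recurrence is no
        -- worse than the first. So an outermost edge can be split off and the interval shrinks by
        -- two points.
        have : max (table V d (a + 2)) (dist (V a) (V (a + 1))) ≤ l ∨
            max (table V d a) (dist (V (a + 2 * d + 2)) (V (a + 2 * d + 3))) ≤ l := by
          rcases min_le_iff.1 ht with h1 | h1
          · exact hN.imp (fun h2 => h2.trans h1) (fun h2 => h2.trans h1)
          · exact min_le_iff.1 h1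
        rcases this with h1 | h1
        · obtain ⟨a', e, h2, h3, h4⟩ := ih (a := a + 2)
            (by have := good_of_table_le ((le_max_left _ _).trans h1)
                rwa [show a + 2 + 2 * (d + 1) = a + 2 + 2 * d + 2 by ring]) (by omega)
          refine ⟨a', e, (Edges.single ((le_max_right _ _).trans h1)).append h2, ?_, h4⟩
          rwa [show a + 2 + 2 * (d + 1) = a + 2 * (d + 1 + 1) by ring] at h3
        · obtain ⟨a', e, h2, h3, h4⟩ := ih (a := a)
            (by have := good_of_table_le ((le_max_left _ _).trans h1)
                rwa [show a + 2 * (d + 1) = a + 2 * d + 2 by ring]) (by omega)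
          refine ⟨a', e, h2, h3.append ?_, h4⟩
          exact Edges.single ((le_max_right _ _).trans h1)

end Intervals

/-! ## The number of candidates -/

/-- The interval `i, …, i + 2 * d + 1` is tried in the last phase of the algorithm. -/
def IsCandidate (V : ℕ → Plane) (θ : ℕ → ℝ) (d i : ℕ) : Prop :=
  IsNecessary V d i ∧ θ (i + 2 * d) - θ i ≤ 2 * Real.pi / 3

section Candidates

variable {n : ℕ} {V : ℕ → Plane} {r θ : ℕ → ℝ} {d i : ℕ}

/-- In a candidate that is not an edge, some edge `i + 2 * u` is longer than the chord, and the
chords of the candidate's parts that start or end with the same point and contain this edge are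
longer, too. -/
theorem IsCandidate.exists_long (h : Directions n V r θ) (hc : IsCandidate V θ d i) (hd : 0 < d) :
    ∃ u ≤ d, dist (V i) (V (i + 2 * d + 1)) < r (i + 2 * u) ∧
      (∀ w, u ≤ w → w < d → dist (V i) (V (i + 2 * d + 1)) < dist (V i) (V (i + 2 * w + 1))) ∧
      (∀ s, 0 < s → s ≤ u →
        dist (V i) (V (i + 2 * d + 1)) < dist (V (i + 2 * s)) (V (i + 2 * d + 1))) := by
  obtain ⟨d, rfl⟩ : ∃ e, d = e + 1 := ⟨d - 1, by omega⟩
  obtain ⟨hN, hτ⟩ := hc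
  rw [IsNecessary, ← show i + 2 * (d + 1) + 1 = i + 2 * d + 3 by ring] at hN
  set L := dist (V i) (V (i + 2 * (d + 1) + 1)) with hL
  -- Necessity is used with the chord `L` as threshold: the first case costs at least `L`, so the
  -- second and the third must cost more than `L`. Any way of solving the interval within `L` that
  -- begins or ends with an edge is therefore a contradiction.
  have hB : ¬ (table V d (i + 2) ≤ L ∧ r i ≤ L) := fun hc => by
    have := (le_max_right _ _).trans_lt hN.1
    rw [lt_max_iff, h.dist_succ] at this
    rcases this with h1 | h1 <;> linarith [hc.1, hc.2]
  have hC : ¬ (table V d i ≤ L ∧ r (i + 2 * d + 2) ≤ L) := fun hc => by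
    have := (le_max_right _ _).trans_lt hN.2
    rw [lt_max_iff, show i + 2 * (d + 1) + 1 = i + 2 * d + 2 + 1 by ring, h.dist_succ] at this
    rcases this with h1 | h1 <;> linarith [hc.1, hc.2]
  obtain ⟨u, hu, hlong⟩ : ∃ u ≤ d + 1, L < r (i + 2 * u) := by
    by_contra hno
    push Not at hno
    refine hB ⟨Good.table_le (Edges.good ⟨d + 1, rfl, fun t ht => ?_⟩) d (by ring), ?_⟩
    · rw [h.dist_succ, show i + 2 + 2 * t = i + 2 * (t + 1) by ring]
      exact hno _ (by omega)
    · simpa using hno 0 (by omega)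
  have hshort : ∀ q, i ≤ q → q ≤ i + 2 * (d + 1) → q ≠ i + 2 * u → r q ≤ L := by
    intro q h1 h2 hne
    by_contra hlt
    push Not at hlt
    exact hne (h.eq_of_dist_lt hτ (Finset.mem_Ico.2 ⟨h1, by omega⟩)
      (Finset.mem_Ico.2 ⟨by omega, by omega⟩) hlt hlong)
  refine ⟨u, hu, hlong, fun w huw hwd => ?_, fun s hs hsu => ?_⟩
  · by_contra hle
    push Not at hle
    refine hC ⟨Good.table_le (b := i + 2 * d + 2) ?_ d rfl,
      hshort _ (by omega) (by omega) (by omega)⟩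
    -- If the partial chord were short, it could be a segment, with the odd-offset edges under it
    -- and the even-offset edges after it. By parity and position this avoids the only long edge, `i
    -- + 2 * u`.
    have h1 : Good V L (i + 1) (i + 2 * w + 1) := Edges.good ⟨w, by ring, fun t ht => by
      rw [h.dist_succ]; exact hshort _ (by omega) (by omega) (by omega)⟩
    refine (h1.nest hle).append_edges ⟨d - w, by omega, fun t ht => ?_⟩
    rw [h.dist_succ]; exact hshort _ (by omega) (by omega) (by omega)
  · by_contra hle
    push Not at hle
    refine hB ⟨Good.table_le (b := i + 2 + 2 * d + 2) ?_ d rfl,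
      hshort _ (by omega) (by omega) (by omega)⟩
    have h1 : Good V L (i + 2 * s + 1) (i + 2 * (d + 1) + 1) :=
      Edges.good ⟨d + 1 - s, by omega, fun t ht => by
        rw [h.dist_succ]; exact hshort _ (by omega) (by omega) (by omega)⟩
    have h2 := h1.nest hle
    rw [show i + 2 * (d + 1) + 1 + 1 = i + 2 + 2 * d + 2 by ring] at h2
    refine Edges.good_append ⟨s - 1, by omega, fun t ht => ?_⟩ h2
    rw [h.dist_succ]; exact hshort _ (by omega) (by omega) (by omega)

/-! ### Steep candidates -/

/-- The first edge makes an angle of at least `π/3` with the chord. -/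
def IsLeftSteep (V : ℕ → Plane) (θ : ℕ → ℝ) (d i : ℕ) : Prop :=
  ∃ D, Directions.IsChordDirection V i (i + 2 * d + 1) D ∧ θ i + Real.pi / 3 ≤ D ∧
    D ≤ θ (i + 2 * d)

/-- The last edge makes an angle of at least `π/3` with the chord. -/
def IsRightSteep (V : ℕ → Plane) (θ : ℕ → ℝ) (d i : ℕ) : Prop :=
  ∃ D, Directions.IsChordDirection V i (i + 2 * d + 1) D ∧ θ i ≤ D ∧
    D + Real.pi / 3 ≤ θ (i + 2 * d)

/-- A candidate that is not an edge contains an edge longer than its chord, which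
`edge_le_of_chordDirection` forbids when both end angles are below `π/3`. -/
theorem IsCandidate.steep (h : Directions n V r θ) (hc : IsCandidate V θ d i) (hd : 0 < d) :
    IsLeftSteep V θ d i ∨ IsRightSteep V θ d i := by
  obtain ⟨u, hu, hlong, -⟩ := hc.exists_long h hd
  obtain ⟨D, hD, h1, h2⟩ := h.exists_chordDirection (i := i) (j := i + 2 * d) (by omega)
    (by linarith [hc.2, Real.pi_pos])
  by_contra hno
  rw [not_or] at hno
  have h3 : D - θ i < Real.pi / 3 := by
    by_contra hge
    exact hno.1 ⟨D, hD, by linarith, h2⟩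
  have h4 : θ (i + 2 * d) - D < Real.pi / 3 := by
    by_contra hge
    exact hno.2 ⟨D, hD, h1, by linarith⟩
  exact absurd (h.edge_le_of_chordDirection hD h3 h4
    (Finset.mem_Ico.2 ⟨by omega, by omega⟩ : i + 2 * u ∈ _)) (not_le.2 hlong)

/-- Past the steep chord only `π/3` of the allowed turn is left, so `prolong_right` applies. The
long edge cannot lie in the added part, and if it lies in the old part, the old chord would have to
exceed the new one, whereas prolonging makes the chord longer. -/
theorem IsLeftSteep.not_isCandidate (h : Directions n V r θ) {e : ℕ} (hl : IsLeftSteep V θ d i)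
    (hde : d < e) : ¬ IsCandidate V θ e i := by
  intro hc
  obtain ⟨u, hu, hlong, hlt, -⟩ := hc.exists_long h (by omega)
  obtain ⟨D, hD, h1, h2⟩ := hl
  obtain ⟨h3, h4⟩ := h.prolong_right (k := i + 2 * e) (by omega) (by omega) hD h2
    (by linarith [hc.2])
  rcases Nat.lt_or_ge d u with hdu | hdu
  · exact absurd (h4 (i + 2 * u) (Finset.mem_Ico.2 ⟨by omega, by omega⟩)) (not_le.2 hlong)
  · exact absurd (h3 (by omega)) (not_lt.2 (hlt d hdu hde).le)

theorem IsRightSteep.not_isCandidate (h : Directions n V r θ) {e j : ℕ}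
    (hl : IsRightSteep V θ d i) (hde : d < e) (hj : i + 2 * d = j + 2 * e) :
    ¬ IsCandidate V θ e j := by
  intro hc
  obtain ⟨u, hu, hlong, -, hlt⟩ := hc.exists_long h (by omega)
  obtain ⟨D, hD, h1, h2⟩ := hl
  rw [hj] at hD h2
  obtain ⟨h3, h4⟩ := h.prolong_left (i := j) (by omega) (by omega) hD h1
    (by linarith [hc.2])
  rcases Nat.lt_or_ge u (e - d) with hdu | hdu
  · exact absurd (h4 (j + 2 * u) (Finset.mem_Ico.2 ⟨by omega, by omega⟩)) (not_le.2 hlong)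
  · have := hlt (e - d) (by omega) hdu
    rw [show j + 2 * (e - d) = i by omega] at this
    exact absurd (h3 (by omega)) (not_lt.2 this.le)

/-! ### Invariance under a shift of the indices by `n` -/

theorem table_add_period (hV : ∀ k, V (k + n) = V k) (d i : ℕ) :
    table V d (i + n) = table V d i := by
  induction d generalizing i with
  | zero => rw [table, table, hV, show i + n + 1 = i + 1 + n by ring, hV]
  | succ d ih =>
    rw [table, table, show i + n + 1 = i + 1 + n by ring, show i + n + 2 = i + 2 + n by ring,
      show i + n + 2 * d + 3 = i + 2 * d + 3 + n by ring,
      show i + n + 2 * d + 2 = i + 2 * d + 2 + n by ring, ih, ih, ih, hV, hV, hV, hV]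

theorem isNecessary_add_period (hV : ∀ k, V (k + n) = V k) (d i : ℕ) :
    IsNecessary V d (i + n) ↔ IsNecessary V d i := by
  cases d with
  | zero => rfl
  | succ d =>
    rw [IsNecessary, IsNecessary, show i + n + 1 = i + 1 + n by ring,
      show i + n + 2 = i + 2 + n by ring,
      show i + n + 2 * d + 3 = i + 2 * d + 3 + n by ring,
      show i + n + 2 * d + 2 = i + 2 * d + 2 + n by ring, table_add_period hV,
      table_add_period hV, table_add_period hV, hV, hV, hV, hV]

theorem isCandidate_add_period (hV : ∀ k, V (k + n) = V k) (h : Directions n V r θ) (d i : ℕ) :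
    IsCandidate V θ d (i + n) ↔ IsCandidate V θ d i := by
  rw [IsCandidate, IsCandidate, isNecessary_add_period hV,
    show i + n + 2 * d = i + 2 * d + n by ring,
    h.add_period, h.add_period, add_sub_add_right_eq_sub]

theorem IsRightSteep.add_period (hV : ∀ k, V (k + n) = V k) (h : Directions n V r θ)
    (hs : IsRightSteep V θ d i) : IsRightSteep V θ d (i + n) := by
  obtain ⟨D, hD, h1, h2⟩ := hs
  refine ⟨D + 2 * Real.pi, ?_, ?_, ?_⟩
  · rw [Directions.IsChordDirection, show i + n + 2 * d + 1 = i + 2 * d + 1 + n by ring, hV, hV,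
      Real.cos_add_two_pi, Real.sin_add_two_pi]
    exact hD
  · rw [h.add_period]; linarith
  · rw [show i + n + 2 * d = i + 2 * d + n by ring, h.add_period]; linarith

theorem eq_of_isRightSteep (hV : ∀ k, V (k + n) = V k) (h : Directions n V r θ) {e j : ℕ}
    (hc : IsCandidate V θ d i) (hs : IsRightSteep V θ d i)
    (hc' : IsCandidate V θ e j) (hs' : IsRightSteep V θ e j) (hi : i < n) (hj : j < n)
    (hd : 2 * d < n) (he : 2 * e < n) (heq : i + 2 * d ≡ j + 2 * e [MOD n]) : d = e ∧ i = j := by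
  have key : ∀ {d e i j : ℕ}, IsCandidate V θ d i → IsRightSteep V θ d i → IsCandidate V θ e j →
      IsRightSteep V θ e j → i + 2 * d = j + 2 * e → d = e := by
    intro d e i j hc hs hc' hs' heq
    rcases lt_trichotomy d e with hlt | rfl | hlt
    · exact absurd hc' (hs.not_isCandidate h hlt heq)
    · rfl
    · exact absurd hc (hs'.not_isCandidate h hlt heq.symm)
  have key2 : ∀ {d e i j : ℕ}, IsCandidate V θ d i → IsRightSteep V θ d i → IsCandidate V θ e j →
      IsRightSteep V θ e j → i < n → j < n → 2 * d < n → 2 * e < n →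
      i + 2 * d ≤ j + 2 * e → i + 2 * d ≡ j + 2 * e [MOD n] → d = e ∧ i = j := by
    intro d e i j hc hs hc' hs' hi hj hd he hle heq
    -- Both end indices are below `2n`, so they agree or differ by `n`; in the second case one
    -- interval is shifted by a period.
    obtain ⟨k, hk⟩ := (Nat.modEq_iff_dvd' hle).1 heq
    have hk2 : k < 2 := by
      by_contra hge
      have : n * 2 ≤ n * k := Nat.mul_le_mul_left n (by omega)
      omega
    interval_cases k
    · have := key hc hs hc' hs' (by omega)
      omega
    · have := key ((isCandidate_add_period hV h d i).2 hc) (hs.add_period hV h) hc' hs' (by omega)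
      omega
  rcases le_total (i + 2 * d) (j + 2 * e) with hle | hle
  · exact key2 hc hs hc' hs' hi hj hd he hle heq
  · have := key2 hc' hs' hc hs hj hi he hd hle heq.symm
    exact ⟨this.1.symm, this.2.symm⟩

/-! ### Counting the candidates -/

open Classical in
theorem sum_isCandidate_le (hV : ∀ k, V (k + n) = V k) (h : Directions n V r θ) :
    ∑ i ∈ Finset.range n, ∑ d ∈ Finset.range (n / 2), (if IsCandidate V θ d i then 1 else 0) ≤
      3 * n := by
  rw [← Finset.sum_product', Finset.sum_boole, Nat.cast_id]
  set A := (Finset.range n ×ˢ Finset.range (n / 2)).filter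
    fun x => IsCandidate V θ x.2 x.1 with hA
  have hmem : ∀ x ∈ A, x.1 < n ∧ x.2 < n / 2 ∧ IsCandidate V θ x.2 x.1 := by
    intro x hx
    simpa [hA, and_assoc] using hx
  -- Candidates are edges, left steep or right steep. The first two kinds are determined by the
  -- starting vertex, the third by the starting vertex of the last edge, so each kind has at most
  -- `n` members.
  have hsub : A ⊆ A.filter (fun x => x.2 = 0) ∪ (A.filter (fun x => IsLeftSteep V θ x.2 x.1) ∪
      A.filter (fun x => IsRightSteep V θ x.2 x.1)) := by
    intro x hx
    simp only [Finset.mem_union, Finset.mem_filter, hx, true_and]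
    rcases Nat.eq_zero_or_pos x.2 with h0 | h0
    · exact Or.inl h0
    · exact Or.inr ((hmem x hx).2.2.steep h h0)
  have c1 : (A.filter fun x => x.2 = 0).card ≤ n := by
    conv_rhs => rw [← Finset.card_range n]
    apply Finset.card_le_card_of_injOn Prod.fst
    · intro x hx
      rw [Finset.mem_coe, Finset.mem_filter] at hx
      simpa using (hmem x hx.1).1
    · intro x hx y hy hxy
      rw [Finset.mem_coe, Finset.mem_filter] at hx hy
      exact Prod.ext hxy (hx.2.trans hy.2.symm)
  have c2 : (A.filter fun x => IsLeftSteep V θ x.2 x.1).card ≤ n := by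
    conv_rhs => rw [← Finset.card_range n]
    apply Finset.card_le_card_of_injOn Prod.fst
    · intro x hx
      rw [Finset.mem_coe, Finset.mem_filter] at hx
      simpa using (hmem x hx.1).1
    · intro x hx y hy hxy
      rw [Finset.mem_coe, Finset.mem_filter] at hx hy
      have hx' := (hmem x hx.1).2.2
      rw [hxy] at hx'
      have hxs := hx.2
      rw [hxy] at hxs
      rcases lt_trichotomy x.2 y.2 with hlt | heq | hlt
      · exact absurd (hmem y hy.1).2.2 (hxs.not_isCandidate h hlt)
      · exact Prod.ext hxy heq
      · exact absurd hx' (hy.2.not_isCandidate h hlt)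
  have c3 : (A.filter fun x => IsRightSteep V θ x.2 x.1).card ≤ n := by
    conv_rhs => rw [← Finset.card_range n]
    apply Finset.card_le_card_of_injOn fun x => (x.1 + 2 * x.2) % n
    · intro x hx
      rw [Finset.mem_coe, Finset.mem_filter] at hx
      have := (hmem x hx.1).1
      simpa using Nat.mod_lt _ (by omega)
    · intro x hx y hy hxy
      rw [Finset.mem_coe, Finset.mem_filter] at hx hy
      have h1 := hmem x hx.1
      have h2 := hmem y hy.1
      have := eq_of_isRightSteep hV h h1.2.2 hx.2 h2.2.2 hy.2 h1.1 h2.1 (by omega) (by omega) hxy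
      exact Prod.ext this.2 this.1
  calc A.card ≤ _ := Finset.card_le_card hsub
    _ ≤ _ := (Finset.card_union_le _ _).trans
      (Nat.add_le_add_left (Finset.card_union_le _ _) _)
    _ ≤ 3 * n := by omega

end Candidates

/-! ## Decomposing a matching into solved intervals -/

section Decomposition

variable {n : ℕ} {V : ℕ → Plane} {r θ : ℕ → ℝ} {l : ℝ} {a b c m : ℕ}

theorem Good.le (h : Good V l a b) : a ≤ b := by
  obtain ⟨d, rfl⟩ := h.exists_eq; omega

theorem Edges.le (h : Edges V l a b) : a ≤ b := by
  obtain ⟨d, rfl, -⟩ := h; omega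

theorem Good.add_period (hV : ∀ k, V (k + n) = V k) (h : Good V l a b) :
    Good V l (a + n) (b + n) := by
  induction h with
  | empty a => exact .empty _
  | @nest a b _ h2 ih =>
    rw [show a + 1 + n = a + n + 1 by ring] at ih
    rw [show b + 1 + n = b + n + 1 by ring]
    exact .nest ih (by rwa [hV, hV])
  | @left a b h1 _ ih =>
    rw [show a + 2 + n = a + n + 2 by ring] at ih
    exact .left (by rwa [show a + n + 1 = a + 1 + n by ring, hV, hV]) ih
  | @right a b _ h2 ih =>
    rw [show b + 2 + n = b + n + 2 by ring]
    exact .right ih (by rwa [show b + n + 1 = b + 1 + n by ring, hV, hV])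

/-- A cycle that consists of two solved intervals can be solved as one interval. -/
theorem Good.exists_cycle (hV : ∀ k, V (k + n) = V k) (h : Good V l a b)
    (hrest : Good V l b (a + n)) : ∃ i, Good V l i (i + n) := by
  induction h with
  | empty a => exact ⟨a, hrest⟩
  | @nest a b _ h2 ih =>
    -- The outermost segment of the first interval is handed to the second one. Seen from the other
    -- side of the polygon, the segment from `a` to `b` encloses the second interval.
    apply ih
    rw [show a + 1 + n = a + n + 1 by ring]
    exact .nest hrest (by rwa [hV, dist_comm])
  | @left a b h1 _ ih =>
    apply ih
    rw [show a + 2 + n = a + n + 2 by ring]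
    exact .right hrest (by rwa [show a + n + 1 = a + 1 + n by ring, hV, hV])
  | @right a b _ h2 ih => exact ih (.left h2 hrest)

/-- A solved interval that turns by at most a right angle can be matched by edges. -/
theorem Good.edges_or_turn (h : Directions n V r θ) (hg : Good V l a b) (hab : a < b) :
    Edges V l a b ∨ Real.pi / 2 < θ (b - 2) - θ a := by
  induction hg with
  | empty a => omega
  | @nest a b h1 h2 _ =>
    rcases le_or_gt (θ (b + 1 - 2) - θ a) (Real.pi / 2) with hle | hlt
    · left
      obtain ⟨d, rfl⟩ := h1.exists_eq
      -- The segment from `a` to `b` is the chord of the whole chain, which turns by at most `π/2`,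
      -- so none of the edges is longer than it. All inner segments can be discarded.
      refine ⟨d + 1, by ring, fun t ht => ?_⟩
      rw [h.dist_succ]
      have e : a + 1 + 2 * d = a + 1 + 2 * d + 1 - 2 + 1 := by omega
      rw [e] at h2
      exact (h.edge_le_dist hle (Finset.mem_Ico.2 ⟨by omega, by omega⟩)).trans h2
    · exact Or.inr hlt
  | @left a b h1 h2 ih =>
    rcases h2.le.eq_or_lt with rfl | hlt
    · exact Or.inl (.single h1)
    · refine (ih hlt).imp (fun he => (Edges.single h1).append he) fun hτ => ?_
      linarith [h.strictMono.monotone (show a ≤ a + 2 by omega)]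
  | @right a b h1 h2 ih =>
    rcases h1.le.eq_or_lt with rfl | hlt
    · exact Or.inl (.single h2)
    · refine (ih hlt).imp (fun he => he.append (.single h2)) fun hτ => ?_
      linarith [h.strictMono.monotone (show b - 2 ≤ b + 2 - 2 by omega)]

/-- The interval `a, …, b - 1` consists of `m` solved intervals, each of which turns by more than a
right angle. -/
inductive Pieces (V : ℕ → Plane) (θ : ℕ → ℝ) (l : ℝ) : ℕ → ℕ → ℕ → Prop
  | one {a b : ℕ} : Good V l a b → a < b → Real.pi / 2 < θ (b - 2) - θ a → Pieces V θ l 1 a b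
  | cons {m a b c : ℕ} : Good V l a b → a < b → Real.pi / 2 < θ (b - 2) - θ a →
      Pieces V θ l m b c → Pieces V θ l (m + 1) a c

theorem Pieces.lt (hp : Pieces V θ l m a b) : a < b := by
  induction hp with
  | one _ h _ => exact h
  | cons _ h _ _ ih => exact h.trans ih

/-- This limits the number of pieces. The index `b - 2` belongs to the last edge of the interval,
since `b` is excluded. -/
theorem Pieces.turn (h : Directions n V r θ) (hp : Pieces V θ l m a b) :
    m * (Real.pi / 2) < θ (b - 2) - θ a := by
  induction hp with
  | one _ _ hτ => simpa using hτ
  | @cons m a b c _ _ hτ _ ih =>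
    push_cast
    linarith [h.strictMono.monotone (show b - 2 ≤ b by omega)]

/-- Adjacent edges are absorbed by a neighbouring piece, whose turn can only grow. So edges never
count as pieces of their own. -/
theorem Pieces.append_edges (h : Directions n V r θ) (hp : Pieces V θ l m a b)
    (he : Edges V l b c) : Pieces V θ l m a c := by
  induction hp with
  | @one a b hg hab hτ =>
    refine .one (hg.append_edges he) (hab.trans_le he.le) ?_
    linarith [h.strictMono.monotone (show b - 2 ≤ c - 2 by have := he.le; omega)]
  | cons hg hab hτ _ ih => exact .cons hg hab hτ (ih he)

theorem Edges.append_pieces (h : Directions n V r θ) (he : Edges V l a b)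
    (hp : Pieces V θ l m b c) : Pieces V θ l m a c := by
  have hle := h.strictMono.monotone he.le
  have hle' := he.le
  cases hp with
  | one hg hab hτ => exact .one (he.good_append hg) (by omega) (by linarith)
  | cons hg hab hτ hp => exact .cons (he.good_append hg) (by omega) (by linarith) hp

theorem Pieces.append (hp : Pieces V θ l m a b) {k : ℕ} (hq : Pieces V θ l k b c) :
    ∃ m', Pieces V θ l m' a c := by
  induction hp with
  | one hg hab hτ => exact ⟨_, .cons hg hab hτ hq⟩
  | cons hg hab hτ _ ih => exact (ih hq).imp' _ fun _ h => .cons hg hab hτ h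

/-- The interval `a, …, b - 1` consists of edges, or of solved intervals that turn by more than a
right angle. -/
def Decomposes (V : ℕ → Plane) (θ : ℕ → ℝ) (l : ℝ) (a b : ℕ) : Prop :=
  Edges V l a b ∨ ∃ m, Pieces V θ l m a b

theorem Decomposes.append (h : Directions n V r θ) (h₁ : Decomposes V θ l a b)
    (h₂ : Decomposes V θ l b c) : Decomposes V θ l a c := by
  rcases h₁ with h₁ | ⟨m, h₁⟩ <;> rcases h₂ with h₂ | ⟨k, h₂⟩
  · exact Or.inl (h₁.append h₂)
  · exact Or.inr ⟨k, h₁.append_pieces h h₂⟩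
  · exact Or.inr ⟨m, h₁.append_edges h h₂⟩
  · exact Or.inr (h₁.append h₂)

theorem Good.decomposes (h : Directions n V r θ) (hg : Good V l a b) (hab : a < b) :
    Decomposes V θ l a b :=
  (hg.edges_or_turn h hab).imp id fun hτ => ⟨1, .one hg hab hτ⟩

/-- `f x` is the first index after `x` of the partner of the point with index `x` in a non-crossing
matching without segments longer than `l`. -/
structure IsPartner (n : ℕ) (V : ℕ → Plane) (l : ℝ) (f : ℕ → ℕ) : Prop where
  lt : ∀ x, x < f x
  lt_add : ∀ x, f x < x + n
  add_period : ∀ x, f (x + n) = f x + n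
  partner : ∀ x, f (f x) = x + n
  nonCrossing : ∀ {x y : ℕ}, x < y → y < f x → f y < f x ∨ x + n < f y
  dist_le : ∀ x, dist (V x) (V (f x)) ≤ l

variable {f : ℕ → ℕ}

/-- Split off the interval bounded by the segment at `a` and continue after it; non-crossing keeps
the rest closed under the matching. The alternative `a + n ≤ f z` in `hclosed` says that the partner
of `z` lies in the interval, before `z`. -/
theorem IsPartner.decomposes (hf : IsPartner n V l f) (h : Directions n V r θ) (hab : a ≤ b)
    (hba : b ≤ a + n) (hclosed : ∀ z, a ≤ z → z < b → f z < b ∨ a + n ≤ f z)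
    (hgood : ∀ z, a ≤ z → f z < b → Good V l z (f z + 1)) : Decomposes V θ l a b := by
  induction hk : b - a using Nat.strong_induction_on generalizing a with
  | _ k ih =>
  rcases hab.eq_or_lt with rfl | hab
  · exact Or.inl (.nil a)
  have hlt := hf.lt a
  have hlt' := hf.lt_add a
  have hfa : f a < b := by
    rcases hclosed a le_rfl hab with h1 | h1 <;> omega
  refine ((hgood a le_rfl hfa).decomposes h (by omega)).append h ?_
  refine ih (b - (f a + 1)) (by omega) (by omega) (by omega) ?_
    (fun z hz hzb => hgood z (by omega) hzb) rfl
  intro z hz hzb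
  rcases hclosed z (by omega) hzb with h1 | h1
  · exact Or.inl h1
  · right
    obtain ⟨w, hw⟩ := Nat.exists_eq_add_of_le (show n ≤ f z by omega)
    have hfw : f w = z := by
      have h2 := hf.partner z
      rw [hw, add_comm n w, hf.add_period] at h2
      omega
    have hzlt := hf.lt_add z
    by_contra hlt2
    rcases Nat.eq_or_lt_of_le (show a ≤ w by omega) with rfl | haw
    · omega
    · rcases Nat.eq_or_lt_of_le (show w ≤ f a by omega) with rfl | hwa
      · rw [hf.partner] at hfw
        omega
      · rcases hf.nonCrossing haw hwa with h3 | h3 <;> omega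

theorem IsPartner.exists_minimal (hf : IsPartner n V l f) {x : ℕ} (hx : ¬ Good V l x (f x + 1)) :
    ∃ y, x ≤ y ∧ f y ≤ f x ∧ ¬ Good V l y (f y + 1) ∧
      ∀ z, y < z → f z < f y → Good V l z (f z + 1) := by
  induction hk : f x - x using Nat.strong_induction_on generalizing x with
  | _ k ih =>
  by_cases hmin : ∀ z, x < z → f z < f x → Good V l z (f z + 1)
  · exact ⟨x, le_rfl, le_rfl, hx, hmin⟩
  · push Not at hmin
    obtain ⟨z, hz1, hz2, hz3⟩ := hmin
    have := hf.lt z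
    obtain ⟨y, h1, h2, h3⟩ := ih (f z - z) (by omega) hz3 rfl
    exact ⟨y, by omega, by omega, h3⟩

/-- Inside a minimal unsolved segment everything is solved, so the interior decomposes. If it
consisted of edges or of one piece, putting the segment around it would solve the whole; hence there
are at least two pieces. -/
theorem IsPartner.exists_pieces (hf : IsPartner n V l f) (h : Directions n V r θ) {x : ℕ}
    (hx : ¬ Good V l x (f x + 1)) :
    ∃ y m, x ≤ y ∧ f y ≤ f x ∧ 2 ≤ m ∧ Pieces V θ l m (y + 1) (f y) := by
  obtain ⟨y, h1, h2, h3, h4⟩ := hf.exists_minimal hx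
  have hlt := hf.lt y
  have hlt' := hf.lt_add y
  have hd : Decomposes V θ l (y + 1) (f y) := by
    refine hf.decomposes h (by omega) (by omega) (fun z hz1 hz2 => ?_)
      fun z hz1 hz2 => h4 z (by omega) hz2
    rcases hf.nonCrossing (show y < z by omega) hz2 with h5 | h5
    · exact Or.inl h5
    · right; omega
  rcases hd with hd | ⟨m, hd⟩
  · exact absurd (.nest hd.good (hf.dist_le y)) h3
  · refine ⟨y, m, h1, h2, ?_, hd⟩
    by_contra hm
    cases hd with
    | one hg _ _ => exact h3 (.nest hg (hf.dist_le y))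
    | cons _ _ _ hp =>
      cases hp <;> omega

theorem IsPartner.exists_decomposes (hf : IsPartner n V l f) (h : Directions n V r θ) :
    ∃ a, Decomposes V θ l a (a + n) := by
  by_cases hall : ∀ x, Good V l x (f x + 1)
  · exact ⟨0, hf.decomposes h (by omega) le_rfl (fun z _ _ => by omega) fun z _ _ => hall z⟩
  · push Not at hall
    obtain ⟨x₀, hx₀⟩ := hall
    obtain ⟨x, m, -, -, hm, hp⟩ := hf.exists_pieces h hx₀
    have hlt := hf.lt x
    have hτ := hp.turn h
    have hm' : (2 : ℝ) ≤ m := by exact_mod_cast hm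
    have hπ := Real.pi_pos
    -- The interior at `x` already turns by more than `π`. An unsolved interval on the other side
    -- would contain another interior turning by more than `π`, and together they exceed the full
    -- turn.
    have hrev : Good V l (f x) (f (f x) + 1) := by
      by_contra hbad
      obtain ⟨y, k, hy1, hy2, hk, hq⟩ := hf.exists_pieces h hbad
      rw [hf.partner] at hy2
      have hτ' := hq.turn h
      have hk' : (2 : ℝ) ≤ k := by exact_mod_cast hk
      have m1 := h.strictMono.monotone (show f x - 2 ≤ y + 1 by omega)
      have m2 := h.strictMono.monotone (show f y - 2 ≤ x + 1 + n by omega)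
      rw [h.add_period] at m2
      nlinarith
    rw [hf.partner, show x + n + 1 = x + 1 + n by ring] at hrev
    exact ⟨x + 1, Decomposes.append h (Or.inr ⟨m, hp⟩)
      (hrev.decomposes h (by have := hf.lt_add x; omega))⟩

/-- The conclusion about a cycle that consists of three solved intervals, the first of which turns
by at most `2π/3`. -/
theorem Good.exists_isCandidate (hV : ∀ k, V (k + n) = V k) (h : Directions n V r θ)
    (h₁ : Good V l a b) (h₂ : Good V l b c) (h₃ : Good V l c (a + n)) (hab : a < b) (hbc : b < c)
    (hca : c < a + n) (hτ : θ (b - 2) - θ a ≤ 2 * Real.pi / 3) :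
    ∃ i d e, 2 * d + 2 * e + 4 < n ∧ IsCandidate V θ d i ∧ Good V l i (i + 2 * d + 2) ∧
      Good V l (i + 2 * d + 2) (i + 2 * d + 2 * e + 4) ∧
      Good V l (i + 2 * d + 2 * e + 4) (i + n) := by
  obtain ⟨i, d, he, he', hg, hN⟩ := h₁.exists_necessary hab
  have hle := he.le
  have hle' := he'.le
  have hg₂ := he'.good_append h₂
  -- The edges trimmed off in front of the necessary pair come, one period later, at the end of the
  -- third interval; those behind it join the second interval.
  have hg₃ : Good V l c (i + n) := by
    refine h₃.append_edges ?_
    obtain ⟨t, rfl, ht⟩ := he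
    refine ⟨t, by ring, fun u hu => ?_⟩
    rw [show a + n + 2 * u = a + 2 * u + n by ring, hV,
      show a + 2 * u + n + 1 = a + 2 * u + 1 + n by ring, hV]
    exact ht u hu
  obtain ⟨k, rfl⟩ := hg₂.exists_eq
  have hk : i + 2 * d + 2 + 2 * k = i + 2 * d + 2 * (k - 1) + 4 := by omega
  rw [hk] at hg₂ hg₃
  refine ⟨i, d, k - 1, by omega, ⟨hN, ?_⟩, hg, hg₂, hg₃⟩
  linarith [h.strictMono.monotone (show i + 2 * d ≤ b - 2 by omega), h.strictMono.monotone hle]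

/-- A cycle that has a non-crossing matching without segments longer than `l` is solved in one of
the ways tried by the algorithm. -/
theorem IsPartner.exists_solution (hV : ∀ k, V (k + n) = V k) (hn : 0 < n)
    (hf : IsPartner n V l f) (h : Directions n V r θ) :
    (∃ i, Good V l i (i + n)) ∨ ∃ i d e, 2 * d + 2 * e + 4 < n ∧ IsCandidate V θ d i ∧
      Good V l i (i + 2 * d + 2) ∧ Good V l (i + 2 * d + 2) (i + 2 * d + 2 * e + 4) ∧
      Good V l (i + 2 * d + 2 * e + 4) (i + n) := by
  obtain ⟨a, ha | ⟨m, ha⟩⟩ := hf.exists_decomposes h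
  · exact Or.inl ⟨a, ha.good⟩
  have hτ := ha.turn h
  have hπ := Real.pi_pos
  have hend := h.strictMono (show a + n - 2 < a + n by omega)
  have hper := h.add_period a
  cases ha with
  | one hg _ _ => exact Or.inl ⟨a, hg⟩
  | cons hg₁ hab _ hp =>
    rename_i b _
    cases hp with
    | one hg₂ _ _ => exact Or.inl (hg₁.exists_cycle hV hg₂)
    | cons hg₂ hbc _ hp =>
      rename_i c _
      cases hp with
      | one hg₃ hca _ =>
        right
        -- The three turns add up to less than `2π`, so one of them is at most `2π/3`; the cycle is
        -- rotated so that this piece comes first.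
        by_cases h1 : θ (b - 2) - θ a ≤ 2 * Real.pi / 3
        · exact hg₁.exists_isCandidate hV h hg₂ hg₃ hab hbc hca h1
        by_cases h2 : θ (c - 2) - θ b ≤ 2 * Real.pi / 3
        · exact hg₂.exists_isCandidate hV h hg₃ (hg₁.add_period hV) hbc hca (by omega) h2
        · refine hg₃.exists_isCandidate hV h (hg₁.add_period hV) (hg₂.add_period hV) hca
            (by omega) (by omega) ?_
          have m1 := h.strictMono.monotone (show b - 2 ≤ b by omega)
          have m2 := h.strictMono.monotone (show c - 2 ≤ c by omega)
          linarith
      | @cons m _ _ _ _ _ _ hp =>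
        exfalso
        push_cast at hτ
        have : (1 : ℝ) ≤ m := by
          have : 1 ≤ m := by cases hp <;> omega
          exact_mod_cast this
        nlinarith

end Decomposition

/-! ## Matchings of the points and of the indices -/

section Matchings

variable {n : ℕ} {V : ℕ → Plane} {l : ℝ} {a b c : ℕ}

theorem eq_of_mod_eq {x y z : ℕ} (hy : x ≤ y) (hyn : y < x + n) (hz : x ≤ z) (hzn : z < x + n)
    (h : y % n = z % n) : y = z := by
  have key : ∀ {y z : ℕ}, x ≤ y → z < x + n → y ≤ z → y % n = z % n → y = z := by
    intro y z hy hzn hle h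
    obtain ⟨k, hk⟩ := (Nat.modEq_iff_dvd' hle).1 h
    rcases Nat.eq_zero_or_pos k with rfl | hk0
    · omega
    · have := Nat.le_mul_of_pos_right n hk0
      omega
  rcases le_total y z with hle | hle
  · exact key hy hzn hle h
  · exact (key hz hyn hle h.symm).symm

/-- The index in `a, …, a + n - 1` that is congruent to `s`. -/
def indexFrom (n a s : ℕ) : ℕ := a + (s + (n - a % n)) % n

theorem le_indexFrom (n a s : ℕ) : a ≤ indexFrom n a s := Nat.le_add_right _ _

theorem indexFrom_lt (hn : 0 < n) (a s : ℕ) : indexFrom n a s < a + n :=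
  Nat.add_lt_add_left (Nat.mod_lt _ hn) _

theorem indexFrom_mod (hn : 0 < n) (a s : ℕ) : indexFrom n a s % n = s % n := by
  have ha := Nat.mod_lt a hn
  rw [indexFrom, Nat.add_mod_mod, ← Nat.mod_add_mod,
    show a % n + (s + (n - a % n)) = s + n by omega,
    Nat.add_mod_right]

theorem IsNonCrossingMatching.isPartner (hn : 0 < n) {v : Fin n → Plane} {σ : Fin n → Fin n}
    (hV : ConvexLift n (lift hn v)) (hσ : IsNonCrossingMatching v σ)
    (hl : ∀ i, dist (v i) (v (σ i)) ≤ l) :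
    IsPartner n (lift hn v) l fun x => indexFrom n x (σ ⟨x % n, Nat.mod_lt x hn⟩) := by
  set f : ℕ → ℕ := fun x => indexFrom n x (σ ⟨x % n, Nat.mod_lt x hn⟩) with hf
  have hmod : ∀ x, f x % n = σ ⟨x % n, Nat.mod_lt x hn⟩ := fun x => by
    rw [hf]; simp only [indexFrom_mod hn, Nat.mod_eq_of_lt (Fin.is_lt _)]
  have hmod' : ∀ x, (⟨f x % n, Nat.mod_lt _ hn⟩ : Fin n) = σ ⟨x % n, Nat.mod_lt x hn⟩ :=
    fun x => Fin.ext (hmod x)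
  have hlt_add : ∀ x, f x < x + n := fun x => indexFrom_lt hn _ _
  have hlt : ∀ x, x < f x := fun x => by
    refine (le_indexFrom n x _).lt_of_ne fun h => hσ.ne_self ⟨x % n, Nat.mod_lt x hn⟩ ?_
    apply Fin.ext
    rw [← hmod x]
    change x = f x at h
    rw [← h]
  have huniq : ∀ {x y : ℕ}, x ≤ y → y < x + n → y % n = f x % n → y = f x := fun h1 h2 h3 =>
    eq_of_mod_eq h1 h2 (hlt _).le (hlt_add _) h3
  have hpartner : ∀ x, f (f x) = x + n := fun x => by
    have h1 := hlt x
    have h2 := hlt_add x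
    refine (huniq (by omega) (by omega) ?_).symm
    rw [hmod (f x), hmod' x, hσ.involutive]
    simp
  refine ⟨hlt, hlt_add, fun x => ?_, hpartner, ?_, fun x => ?_⟩
  · simp only [hf, indexFrom, Nat.add_mod_right]; ring
  · intro x y hxy hyf
    by_contra hcon
    push Not at hcon
    have h1 := hlt_add x
    have hne1 : f x ≠ f y := fun h => by
      have h2 := congrArg f h
      rw [hpartner, hpartner] at h2
      omega
    have hne2 : f y ≠ x + n := fun h => by
      have h2 := congrArg f h
      have h3 := hpartner x
      have h4 : f (x + n) = f x + n := by simp only [hf, indexFrom, Nat.add_mod_right]; ring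
      rw [hpartner, h4] at h2
      omega
    -- What remains is `x < y < f x < f y < x + n`, in which case the two segments are crossing
    -- diagonals.
    refine hV.segment_cross hxy hyf (show f x < f y by omega) (by omega) ?_
    have hd := hσ.nonCrossing ⟨x % n, Nat.mod_lt x hn⟩ ⟨y % n, Nat.mod_lt y hn⟩ (fun h => ?_)
      fun h => ?_
    · rw [← hmod', ← hmod'] at hd
      exact hd
    · have := eq_of_mod_eq (x := x) hxy.le (by omega) le_rfl (by omega) (Fin.ext_iff.1 h)
      omega
    · have h2 := Fin.ext_iff.1 h
      rw [← hmod x] at h2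
      have := huniq hxy.le (by omega) h2
      omega
  · have := hl ⟨x % n, Nat.mod_lt x hn⟩
    rw [← hmod'] at this
    exact this

/-! ### From solved intervals back to matchings of the points -/

/-- The indices `a, …, b - 1` have a non-crossing matching without segments longer than `l`. -/
def Matched (V : ℕ → Plane) (l : ℝ) (a b : ℕ) : Prop :=
  ∃ σ : ℕ → ℕ, (∀ x, a ≤ x → x < b → a ≤ σ x ∧ σ x < b ∧ σ x ≠ x ∧ σ (σ x) = x ∧
      dist (V x) (V (σ x)) ≤ l) ∧
    ∀ x y, a ≤ x → x < b → x < y → y < σ x → x < σ y ∧ σ y < σ x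

theorem Matched.empty (a : ℕ) : Matched V l a a :=
  ⟨id, fun x _ _ => by omega, fun x y _ _ => by omega⟩

theorem Matched.append (h₁ : Matched V l a b) (h₂ : Matched V l b c) (hab : a ≤ b) (hbc : b ≤ c) :
    Matched V l a c := by
  obtain ⟨σ, hσ, hσ'⟩ := h₁
  obtain ⟨τ, hτ, hτ'⟩ := h₂
  refine ⟨fun x => if x < b then σ x else τ x, fun x hx hxc => ?_, fun x y hx hxc hxy hy => ?_⟩
  · by_cases h : x < b
    · obtain ⟨h1, h2, h3, h4, h5⟩ := hσ x hx h
      simp only [h, h2, if_true]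
      exact ⟨h1, by omega, h3, h4, h5⟩
    · obtain ⟨h1, h2, h3, h4, h5⟩ := hτ x (by omega) hxc
      simp only [h, not_lt.2 h1, if_false]
      exact ⟨by omega, h2, h3, h4, h5⟩
  · by_cases h : x < b
    · simp only [h, if_true] at hy ⊢
      have := (hσ x hx h).2.1
      simp only [show y < b by omega, if_true]
      exact hσ' x y hx h hxy hy
    · simp only [h, if_false] at hy ⊢
      simp only [show ¬ y < b by omega, if_false]
      exact hτ' x y (by omega) hxc hxy hy

theorem Matched.nest (h : Matched V l (a + 1) b) (hab : a + 1 ≤ b) (hd : dist (V a) (V b) ≤ l) :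
    Matched V l a (b + 1) := by
  obtain ⟨σ, hσ, hσ'⟩ := h
  refine ⟨fun x => if x = a then b else if x = b then a else σ x, fun x hx hxb => ?_,
    fun x y hx hxb hxy hy => ?_⟩
  · rcases eq_or_ne x a with rfl | hxa
    · simp only [if_true, show b ≠ x by omega, if_false]
      exact ⟨by omega, by omega, by omega, trivial, hd⟩
    rcases eq_or_ne x b with rfl | hxb'
    · simp only [if_true, hxa, if_false]
      exact ⟨by omega, by omega, by omega, trivial, by rwa [dist_comm]⟩
    · obtain ⟨h1, h2, h3, h4, h5⟩ := hσ x (by omega) (by omega)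
      simp only [hxa, hxb', if_false, show σ x ≠ a by omega, show σ x ≠ b by omega]
      exact ⟨by omega, by omega, h3, h4, h5⟩
  · rcases eq_or_ne x a with rfl | hxa
    · simp only [if_true] at hy ⊢
      simp only [show y ≠ x by omega, show y ≠ b by omega, if_false]
      obtain ⟨h1, h2, -⟩ := hσ y (by omega) (by omega)
      omega
    rcases eq_or_ne x b with rfl | hxb'
    · simp only [if_true, hxa, if_false] at hy
      omega
    · simp only [hxa, hxb', if_false] at hy ⊢
      obtain ⟨h1, h2, -⟩ := hσ x (by omega) (by omega)
      simp only [show y ≠ a by omega, show y ≠ b by omega, if_false]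
      exact hσ' x y (by omega) (by omega) hxy hy

theorem Matched.edge (h : dist (V a) (V (a + 1)) ≤ l) : Matched V l a (a + 2) :=
  (Matched.empty (a + 1)).nest le_rfl h

theorem Good.matched (h : Good V l a b) : Matched V l a b := by
  induction h with
  | empty a => exact .empty a
  | nest h1 h2 ih => exact ih.nest h1.le h2
  | left h1 h2 ih => exact (Matched.edge h1).append ih (by omega) h2.le
  | right h1 h2 ih => exact ih.append (.edge h2) h1.le (by omega)

/-- Described by their first endpoints within the period, two segments are nested or side by side;
in both positions convexity makes them disjoint. -/
theorem Matched.exists_isNonCrossingMatching (hn : 0 < n) {v : Fin n → Plane}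
    (hV : ConvexLift n (lift hn v)) (h : Matched (lift hn v) l a (a + n)) :
    ∃ σ, IsNonCrossingMatching v σ ∧ ∀ i, dist (v i) (v (σ i)) ≤ l := by
  obtain ⟨σ, hσ, hσ'⟩ := h
  have hle : ∀ i : Fin n, a ≤ indexFrom n a i := fun i => le_indexFrom n a i
  have hlt : ∀ i : Fin n, indexFrom n a i < a + n := fun i => indexFrom_lt hn a i
  have hmod : ∀ i : Fin n, (⟨indexFrom n a i % n, Nat.mod_lt _ hn⟩ : Fin n) = i := fun i =>
    Fin.ext (by simp only [indexFrom_mod hn, Nat.mod_eq_of_lt i.is_lt])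
  have hidx : ∀ x, a ≤ x → x < a + n → indexFrom n a (x % n) = x := fun x h1 h2 =>
    eq_of_mod_eq (le_indexFrom n a _) (indexFrom_lt hn a _) h1 h2
      (by rw [indexFrom_mod hn, Nat.mod_mod])
  set τ : Fin n → Fin n := fun i => ⟨σ (indexFrom n a i) % n, Nat.mod_lt _ hn⟩ with hτ
  have hvτ : ∀ i, v (τ i) = lift hn v (σ (indexFrom n a i)) := fun i => rfl
  have hv : ∀ i, v i = lift hn v (indexFrom n a i) := fun i => by
    rw [lift, hmod]
  have hidxτ : ∀ i, indexFrom n a (τ i) = σ (indexFrom n a i) := fun i => by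
    obtain ⟨h1, h2, -⟩ := hσ _ (hle i) (hlt i)
    exact hidx _ h1 h2
  have hτeq : ∀ i k : Fin n, indexFrom n a k = σ (indexFrom n a i) → k = τ i := fun i k h => by
    rw [← hmod k]
    apply Fin.ext
    simp only [h, hτ]
  have key : ∀ x y, a ≤ x → x < a + n → a ≤ y → y < a + n → x < σ x → y < σ y → x < y →
      Disjoint (segment ℝ (lift hn v x) (lift hn v (σ x)))
        (segment ℝ (lift hn v y) (lift hn v (σ y))) := by
    intro x y hx hxn hy hyn hxs hys hxy
    obtain ⟨-, h2, -, h4, -⟩ := hσ x hx hxn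
    obtain ⟨-, h2', -, h4', -⟩ := hσ y hy hyn
    rcases lt_trichotomy y (σ x) with hlt | heq | hgt
    · have := hσ' x y hx hxn hxy hlt
      exact hV.segment_nest hxy this.1 hlt this.2 (by omega)
    · rw [heq, h4] at hys
      omega
    · exact hV.segment_side hxs hgt (by omega) (by omega) (by omega)
  have key2 : ∀ x y, a ≤ x → x < a + n → a ≤ y → y < a + n → x < σ x → y < σ y → x ≠ y →
      Disjoint (segment ℝ (lift hn v x) (lift hn v (σ x)))
        (segment ℝ (lift hn v y) (lift hn v (σ y))) := by
    intro x y hx hxn hy hyn hxs hys hne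
    rcases Nat.lt_or_gt_of_ne hne with hlt | hgt
    · exact key x y hx hxn hy hyn hxs hys hlt
    · exact (key y x hy hyn hx hxn hys hxs hgt).symm
  -- each segment is described by its first endpoint
  have hfirst : ∀ x, a ≤ x → x < a + n → ∃ z, (z = x ∨ z = σ x) ∧ a ≤ z ∧ z < a + n ∧ z < σ z ∧
      segment ℝ (lift hn v x) (lift hn v (σ x)) = segment ℝ (lift hn v z) (lift hn v (σ z)) := by
    intro x hx hxn
    obtain ⟨h1, h2, h3, h4, -⟩ := hσ x hx hxn
    rcases Nat.lt_or_gt_of_ne h3 with hlt | hgt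
    · exact ⟨σ x, Or.inr rfl, h1, h2, by rwa [h4], by rw [h4, segment_symm]⟩
    · exact ⟨x, Or.inl rfl, hx, hxn, hgt, rfl⟩
  refine ⟨τ, ⟨fun i => ?_, fun i h => ?_, fun i k hki hkτ => ?_⟩, fun i => ?_⟩
  · refine (hτeq (τ i) i ?_).symm
    rw [hidxτ, (hσ _ (hle i) (hlt i)).2.2.2.1]
  · exact (hσ _ (hle i) (hlt i)).2.2.1 (by rw [← hidxτ, h])
  · rw [hvτ, hvτ, hv i, hv k]
    have hne1 : indexFrom n a k ≠ indexFrom n a i := fun h => hki (by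
      rw [← hmod k, ← hmod i]; exact Fin.ext (by simp only [h]))
    have hne2 : indexFrom n a k ≠ σ (indexFrom n a i) := fun h => hkτ (hτeq i k h)
    have h4 := (hσ _ (hle i) (hlt i)).2.2.2.1
    have h4' := (hσ _ (hle k) (hlt k)).2.2.2.1
    obtain ⟨x, hx, hx1, hx2, hx3, hx4⟩ := hfirst _ (hle i) (hlt i)
    obtain ⟨y, hy, hy1, hy2, hy3, hy4⟩ := hfirst _ (hle k) (hlt k)
    rw [hx4, hy4]
    refine key2 x y hx1 hx2 hy1 hy2 hx3 hy3 fun hxy => ?_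
    rcases hx with hx | hx <;> rcases hy with hy | hy
    · exact hne1 (by rw [← hx, ← hy, hxy])
    · exact hne2 (by rw [← hx, hxy, hy, h4'])
    · exact hne2 (by rw [← hx, ← hy, hxy])
    · exact hne1 (by rw [← h4, ← h4', ← hx, ← hy, hxy])
  · rw [hvτ, hv i]
    exact (hσ _ (hle i) (hlt i)).2.2.2.2

end Matchings

/-! ## Reasoning about programs -/

theorem Cmd.iterate_spec {body : ℕ → State → State × ℕ} {P : ℕ → State → Prop} {c : ℕ → ℕ} {m : ℕ}
    {s : State} (h₀ : P 0 s)
    (h : ∀ t s', t < m → P t s' → P (t + 1) (body t s').1 ∧ (body t s').2 ≤ c t) :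
    P m (iterate body m s).1 ∧ (iterate body m s).2 ≤ ∑ t ∈ Finset.range m, (1 + c t) := by
  induction m with
  | zero => exact ⟨h₀, le_rfl⟩
  | succ m ih =>
    obtain ⟨h1, h2⟩ := ih fun t s' ht => h t s' (by omega)
    obtain ⟨h3, h4⟩ := h m _ (by omega) h1
    refine ⟨h3, ?_⟩
    rw [Finset.sum_range_succ]
    exact Nat.add_le_add h2 (Nat.add_le_add_left h4 1)

/-- The state in which the body of a loop over `x` starts. -/
def State.setInt (s : State) (x : IVar) (t : ℕ) : State :=
  { s with int := Function.update s.int x t }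

theorem Cmd.forLoop_spec {x : IVar} {p : IExp} {body : Cmd} {P : ℕ → State → Prop} {c : ℕ → ℕ}
    {m : ℕ} {s : State} (hm : p.eval s = m) (h₀ : P 0 s)
    (h : ∀ t s', t < m → P t s' →
      P (t + 1) (body.exec (s'.setInt x t)).1 ∧ (body.exec (s'.setInt x t)).2 ≤ c t) :
    P m ((forLoop x p body).exec s).1 ∧
      ((forLoop x p body).exec s).2 ≤ 1 + p.cost + ∑ t ∈ Finset.range m, (1 + c t) := by
  subst hm
  have := iterate_spec (body := fun t s' => exec body (s'.setInt x t)) h₀ h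
  exact ⟨this.1, Nat.add_le_add_left this.2 _⟩

/-! ## Filling the table -/

namespace Algorithm

/-- The body of the loop of `initTable`. -/
def initBody : Cmd :=
  .block [
    .store .S i i 0,
    .setInt .j (fwd i 1),
    .store .S i j (len i j),
    .storeFlag .necessary i j .tt]

/-- The body of the loops of `fillTable`. -/
def fillBody : Cmd :=
  .block [
    .setInt .j (fwd i (2 * d + 3)),
    .setReal .a (.max (tab (fwd i 1) (bwd j 1)) (len i j)),
    .setReal .b (.max (tab (fwd i 2) j) (len i (fwd i 1))),
    .setReal .c (.max (tab i (bwd j 2)) (len (bwd j 1) j)),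
    .store .S i j (.min (.var .a) (.min (.var .b) (.var .c))),
    .storeFlag .necessary i j
      (.and (.lt (.var .a) (.var .b)) (.lt (.var .a) (.var .c)))]

end Algorithm

/-- The state holds the periodic sequence `V` of `n` points. -/
structure Holds (n : ℕ) (V : ℕ → Plane) (s : State) : Prop where
  size : s.int .n = n
  xcoord : ∀ k, s.arr (.coord, k % n, 0) = V k 0
  ycoord : ∀ k, s.arr (.coord, k % n, 1) = V k 1

/-- The state holds the table entries of the intervals with at most `2 * D` points. -/
def HasTable (n : ℕ) (V : ℕ → Plane) (D : ℕ) (s : State) : Prop :=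
  ∀ d < D, ∀ k, s.arr (.S, k % n, (k + 2 * d + 1) % n) = table V d k ∧
    (s.flag (.necessary, k % n, (k + 2 * d + 1) % n) ↔ IsNecessary V d k)

/-- The distance of two vertices as it is computed by the algorithm. -/
def storedDist (s : State) (p q : ℕ) : ℝ :=
  √((s.arr (.coord, p, 0) - s.arr (.coord, q, 0)) * (s.arr (.coord, p, 0) - s.arr (.coord, q, 0)) +
    (s.arr (.coord, p, 1) - s.arr (.coord, q, 1)) * (s.arr (.coord, p, 1) - s.arr (.coord, q, 1)))

section Program

variable {n : ℕ} {V : ℕ → Plane} {s : State}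

theorem Holds.storedDist (hs : Holds n V s) (p q : ℕ) :
    storedDist s (p % n) (q % n) = dist (V p) (V q) := by
  rw [Bottleneck.storedDist, dist_eq_sqrt, hs.xcoord, hs.xcoord, hs.ycoord, hs.ycoord]

theorem Holds.congr {s' : State} (hs : Holds n V s) (hn : s'.int .n = s.int .n)
    (hc : ∀ p q, s'.arr (.coord, p, q) = s.arr (.coord, p, q)) : Holds n V s' :=
  ⟨hn.trans hs.size, fun k => (hc _ _).trans (hs.xcoord k), fun k => (hc _ _).trans (hs.ycoord k)⟩

theorem HasTable.congr {s' : State} {D : ℕ} (hs : HasTable n V D s) (ha : s'.arr = s.arr)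
    (hf : s'.flag = s.flag) : HasTable n V D s' := by
  unfold HasTable
  rw [ha, hf]
  exact hs

theorem table_mod (hV : ∀ k, V (k + n) = V k) (d k : ℕ) : table V d (k % n) = table V d k :=
  Function.Periodic.map_mod_nat (f := table V d) (table_add_period hV d) k

theorem isNecessary_mod (hV : ∀ k, V (k + n) = V k) (d k : ℕ) :
    IsNecessary V d (k % n) ↔ IsNecessary V d k :=
  Iff.of_eq <| Function.Periodic.map_mod_nat (f := IsNecessary V d)
    (fun k => propext (isNecessary_add_period hV d k)) k

theorem mod_add_pred {x t : ℕ} (ht : t ≤ n) (hx : t ≤ x) : (x % n + (n - t)) % n = (x - t) % n := by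
  rw [Nat.mod_add_mod, show x + (n - t) = x - t + n by omega, Nat.add_mod_right]

theorem initTable_spec (hn : 2 ≤ n) (hs : Holds n V s) :
    Holds n V (Algorithm.initTable.exec s).1 ∧ HasTable n V 1 (Algorithm.initTable.exec s).1 ∧
      (Algorithm.initTable.exec s).2 ≤ 2 + 101 * n := by
  have key := Cmd.forLoop_spec (x := .i) (p := .var .n) (body := Algorithm.initBody) (s := s)
    (m := n) (c := fun _ => 100)
    (P := fun t s' => Holds n V s' ∧ ∀ k, k % n < t →
      s'.arr (.S, k % n, (k + 1) % n) = table V 0 k ∧ s'.flag (.necessary, k % n, (k + 1) % n))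
    hs.size ⟨hs, fun k hk => by omega⟩ ?_
  · obtain ⟨⟨h1, h2⟩, h3⟩ := key
    refine ⟨h1, ?_, h3.trans ?_⟩
    · intro d hd k
      obtain rfl : d = 0 := by omega
      obtain ⟨h4, h5⟩ := h2 k (Nat.mod_lt _ (by omega))
      exact ⟨h4, iff_of_true h5 trivial⟩
    · rw [Finset.sum_const, Finset.card_range, smul_eq_mul]
      simp only [IExp.cost]
      omega
  · rintro t s' ht ⟨hs', hP⟩
    -- The number of steps of the loop body does not depend on the state, so its bound is checked by
    -- evaluation.
    refine ⟨?_, Nat.le_of_ble_eq_true rfl⟩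
    set J := (t + 1) % s'.int .n with hJ
    set s'' := s'.setInt .i t
    have hexec : (Algorithm.initBody.exec s'').1 =
        { int := Function.update s''.int .j J
          real := s'.real
          arr := Function.update (Function.update s'.arr (.S, t, t) ((0 : ℕ) : ℝ)) (.S, t, J)
            (storedDist s' t J)
          flag := Function.update s'.flag (.necessary, t, J) True } := rfl
    rw [hexec]
    refine ⟨hs'.congr rfl fun p q => by simp, fun k hk => ?_⟩
    rcases Nat.lt_or_ge (k % n) t with hlt | hge
    · have hne : k % n ≠ t := by omega
      simpa [hne] using hP k hlt
    · have heq : k % n = t := by omega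
      have hJ' : (k + 1) % n = J := by rw [hJ, hs'.size, ← heq, Nat.mod_add_mod]
      rw [heq, hJ']
      simp only [Function.update_self, and_true]
      rw [← heq, ← hJ', hs'.storedDist]
      rfl

theorem fillTable_spec {N : ℕ} (hN : 1 ≤ N) (hn : n = 2 * N) (hV : ∀ k, V (k + n) = V k)
    (hs : Holds n V s) (ht : HasTable n V 1 s) :
    Holds n V (Algorithm.fillTable.exec s).1 ∧ HasTable n V N (Algorithm.fillTable.exec s).1 ∧
      (Algorithm.fillTable.exec s).2 ≤ 6 + N * (3 + 501 * n) := by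
  have hn2 : 2 ≤ n := by omega
  have key := Cmd.forLoop_spec (x := .d) (p := .var .n / 2 - 1)
    (body := .forLoop .i (.var .n) Algorithm.fillBody) (s := s) (m := N - 1)
    (c := fun _ => 2 + 501 * n) (P := fun u s' => Holds n V s' ∧ HasTable n V (u + 1) s')
    (by change s.int .n / 2 - 1 = N - 1; rw [hs.size]; omega) ⟨hs, ht⟩ ?_
  · obtain ⟨⟨h1, h2⟩, h3⟩ := key
    rw [show N - 1 + 1 = N by omega] at h2
    refine ⟨h1, h2, h3.trans ?_⟩
    rw [Finset.sum_const, Finset.card_range, smul_eq_mul]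
    have : (N - 1) * (1 + (2 + 501 * n)) ≤ N * (3 + 501 * n) := by
      rw [← add_assoc]; exact Nat.mul_le_mul_right _ (by omega)
    have hc : (.var .n / 2 - 1 : IExp).cost = 5 := rfl
    rw [hc]
    omega
  · rintro u s₁ hu ⟨hs₁, ht₁⟩
    have key₂ := Cmd.forLoop_spec (x := .i) (p := .var .n) (body := Algorithm.fillBody)
      (s := s₁.setInt .d u)
      (m := n) (c := fun _ => 500)
      (P := fun t s' => Holds n V s' ∧ s'.int .d = u ∧ HasTable n V (u + 1) s' ∧
        ∀ k, k % n < t → s'.arr (.S, k % n, (k + 2 * (u + 1) + 1) % n) = table V (u + 1) k ∧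
          (s'.flag (.necessary, k % n, (k + 2 * (u + 1) + 1) % n) ↔ IsNecessary V (u + 1) k))
      hs₁.size ⟨hs₁.congr rfl fun p q => rfl, rfl, ht₁.congr rfl rfl, fun k hk => by omega⟩ ?_
    · obtain ⟨⟨h1, -, h2, h3⟩, h4⟩ := key₂
      refine ⟨⟨h1, fun d hd k => ?_⟩, h4.trans ?_⟩
      · rcases Nat.lt_or_ge d (u + 1) with hlt | hge
        · exact h2 d hlt k
        · obtain rfl : d = u + 1 := by omega
          exact h3 k (Nat.mod_lt _ (by omega))
      · rw [Finset.sum_const, Finset.card_range, smul_eq_mul]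
        simp only [IExp.cost]
        omega
    · rintro t s' htn ⟨hs', hd', ht', hP⟩
      refine ⟨?_, Nat.le_of_ble_eq_true rfl⟩
      set J := (t + (2 * s'.int .d + 3)) % s'.int .n with hJ
      set s'' := s'.setInt .i t
      set A := max (s'.arr (.S, (t + 1) % s'.int .n, (J + (s'.int .n - 1)) % s'.int .n))
        (storedDist s' t J) with hA
      set B := max (s'.arr (.S, (t + 2) % s'.int .n, J))
        (storedDist s' t ((t + 1) % s'.int .n)) with hB
      set C := max (s'.arr (.S, t, (J + (s'.int .n - 2)) % s'.int .n))
        (storedDist s' ((J + (s'.int .n - 1)) % s'.int .n) J) with hC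
      have hexec : (Algorithm.fillBody.exec s'').1 =
          { int := Function.update s''.int .j J
            real := Function.update (Function.update (Function.update s'.real .a A) .b B) .c C
            arr := Function.update s'.arr (.S, t, J) (min A (min B C))
            flag := Function.update s'.flag (.necessary, t, J) (A < B ∧ A < C) } := rfl
      rw [hexec]
      have htt : t % n = t := Nat.mod_eq_of_lt htn
      rw [hd', hs'.size] at hJ
      have hJ₁ : J = (t + 2 * u + 3) % n := by rw [hJ]; ring_nf
      have hJm : (J + (n - 1)) % n = (t + 2 * u + 2) % n := by
        rw [hJ₁, mod_add_pred (by omega) (by omega)]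
        congr 1
      have hJm₂ : (J + (n - 2)) % n = (t + 2 * u + 1) % n := by
        rw [hJ₁, mod_add_pred (by omega) (by omega)]
        congr 1
      have hA' : A = max (table V u (t + 1)) (dist (V t) (V (t + 2 * u + 3))) := by
        have h1 := (ht' u (by omega) (t + 1)).1
        have h2 := hs'.storedDist t (t + 2 * u + 3)
        rw [show t + 1 + 2 * u + 1 = t + 2 * u + 2 by ring] at h1
        rw [htt, ← hJ₁] at h2
        rw [hA, hs'.size, hJm, h1, h2]
      have hB' : B = max (table V u (t + 2)) (dist (V t) (V (t + 1))) := by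
        have h1 := (ht' u (by omega) (t + 2)).1
        have h2 := hs'.storedDist t (t + 1)
        rw [show t + 2 + 2 * u + 1 = t + 2 * u + 3 by ring, ← hJ₁] at h1
        rw [htt] at h2
        rw [hB, hs'.size, h1, h2]
      have hC' : C = max (table V u t) (dist (V (t + 2 * u + 2)) (V (t + 2 * u + 3))) := by
        have h1 := (ht' u (by omega) t).1
        have h2 := hs'.storedDist (t + 2 * u + 2) (t + 2 * u + 3)
        rw [htt] at h1
        rw [← hJ₁] at h2
        rw [hC, hs'.size, hJm, hJm₂, h1, h2]
      refine ⟨hs'.congr rfl fun p q => by simp, hd', fun d hd k => ?_, fun k hk => ?_⟩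
      · have hne : ¬ (k % n = t ∧ (k + 2 * d + 1) % n = J) := by
          rintro ⟨h1, h2⟩
          rw [hJ₁, ← h1, show k % n + 2 * u + 3 = k % n + (2 * u + 3) by ring,
            show k + 2 * d + 1 = k + (2 * d + 1) by ring, Nat.mod_add_mod] at h2
          have := eq_of_mod_eq (x := k) (by omega) (by omega) (by omega) (by omega) h2
          omega
        simpa [Prod.ext_iff, hne] using ht' d hd k
      · rcases Nat.lt_or_ge (k % n) t with hlt | hge
        · have hne : k % n ≠ t := by omega
          simpa [Prod.ext_iff, hne] using hP k hlt
        · have heq : k % n = t := by omega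
          have hJ' : (k + 2 * (u + 1) + 1) % n = J := by
            rw [hJ₁, ← heq, show k % n + 2 * u + 3 = k % n + (2 * u + 3) by ring, Nat.mod_add_mod]
            congr 1
          rw [heq, hJ', ← table_mod hV, ← isNecessary_mod hV, heq]
          simp only [Function.update_self]
          rw [hA', hB', hC']
          exact ⟨rfl, Iff.rfl⟩

end Program

/-! ## Turning angles -/

theorem exists_arg_eq {r θ : ℝ} (hr : 0 < r) :
    ∃ k : ℤ, Complex.arg ⟨r * Real.cos θ, r * Real.sin θ⟩ = θ + 2 * Real.pi * k := by
  refine ⟨⌊(Real.pi - θ) / (2 * Real.pi)⌋, ?_⟩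
  rw [← Complex.arg_mul_cos_add_sin_mul_I_sub hr]
  have : (⟨r * Real.cos θ, r * Real.sin θ⟩ : ℂ) =
      r * (Complex.cos θ + Complex.sin θ * Complex.I) := by
    apply Complex.ext <;> simp [← Complex.ofReal_cos, ← Complex.ofReal_sin]
  rw [this]; ring

/-- The difference of two angles in `(-π, π]`, shifted into `[0, 2π)`. -/
theorem shifted_sub_eq {α β θ φ : ℝ} {k m : ℤ} (hα : α = θ + 2 * Real.pi * k)
    (hβ : β = φ + 2 * Real.pi * m) (h₁ : -Real.pi < α) (h₂ : α ≤ Real.pi) (h₃ : -Real.pi < β)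
    (h₄ : β ≤ Real.pi) (h₅ : 0 ≤ φ - θ) (h₆ : φ - θ < 2 * Real.pi) :
    (if β - α < 0 then β - α + 2 * Real.pi else β - α) = φ - θ := by
  have hπ := Real.pi_pos
  have key : ∀ j : ℤ, ∀ y : ℝ, y = φ - θ + 2 * Real.pi * j → 0 ≤ y → y < 2 * Real.pi →
      y = φ - θ := by
    intro j y hy h0 h1
    have h2 : (j : ℝ) < 1 := by
      by_contra hge
      push Not at hge
      nlinarith
    have h3 : (-1 : ℝ) < j := by
      by_contra hge
      push Not at hge
      nlinarith
    have h4 : j < 1 := by exact_mod_cast h2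
    have h5 : -1 < j := by exact_mod_cast h3
    obtain rfl : j = 0 := by omega
    rw [hy]; simp
  split_ifs with hlt
  · exact key (m - k + 1) _ (by rw [hα, hβ]; push_cast; ring) (by linarith) (by linarith)
  · exact key (m - k) _ (by rw [hα, hβ]; push_cast; ring) (by linarith) (by linarith)

/-! ## The solutions tried by the algorithm -/

theorem Cmd.exec_ite_pos {b : BExp} {c₁ c₂ : Cmd} {s : State} (h : b.eval s) :
    (Cmd.ite b c₁ c₂).exec s = ((c₁.exec s).1, 1 + b.cost + (c₁.exec s).2) := by
  simp [Cmd.exec, h]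

theorem Cmd.exec_ite_neg {b : BExp} {c₁ c₂ : Cmd} {s : State} (h : ¬ b.eval s) :
    (Cmd.ite b c₁ c₂).exec s = ((c₂.exec s).1, 1 + b.cost + (c₂.exec s).2) := by
  simp [Cmd.exec, h]

namespace Algorithm

/-- The body of the innermost loop of `threeCascades`. -/
def tryBody : Cmd :=
  .block [
    .setInt .k (fwd (j + 1) (2 * e + 1)),
    .setReal .best (.min (.var .best)
      (.max (tab i j) (.max (tab (fwd j 1) k) (tab (fwd k 1) (bwd i 1)))))]

/-- The test in `threeCascades`. -/
def candidateTest : BExp := .and (.get .necessary i j) (.le (.var .theta) (2 * .pi / 3))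

/-- The body of the two outer loops of `threeCascades`. -/
def pairBody : Cmd :=
  .block [
    .setInt .j (fwd i (2 * d + 1)),
    turningAngle,
    .ite candidateTest (.forLoop .e ((n - (2 * d + 2)) / 2) tryBody) .skip]

/-- The angle computed by `turningAngle`. -/
def storedAngle (s : State) : ℝ :=
  if (dir (bwd j 1) j).eval s - (dir i (fwd i 1)).eval s < 0 then
    (dir (bwd j 1) j).eval s - (dir i (fwd i 1)).eval s + 2 * Real.pi
  else (dir (bwd j 1) j).eval s - (dir i (fwd i 1)).eval s

theorem turningAngle_exec (s : State) :
    (turningAngle.exec s).1 = { s with real := Function.update s.real .theta (storedAngle s) } ∧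
      (turningAngle.exec s).2 ≤ 100 := by
  set x := (dir (bwd j 1) j).eval s - (dir i (fwd i 1)).eval s with hx
  set s₁ : State := { s with real := Function.update s.real .theta x } with hs₁
  have h1 : (turningAngle.exec s).1 = (Cmd.exec (.ite (.lt (.var .theta) 0)
      (.setReal .theta (.var .theta + 2 * .pi)) .skip) s₁).1 := rfl
  have h2 : (turningAngle.exec s).2 = (Cmd.exec (.setReal .theta
      (dir (bwd j 1) j - dir i (fwd i 1))) s).2 + ((Cmd.exec (.ite (.lt (.var .theta) 0)
      (.setReal .theta (.var .theta + 2 * .pi)) .skip) s₁).2 + 1) := rfl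
  have hcond : (BExp.lt (.var .theta) 0).eval s₁ ↔ x < 0 := by
    change (s₁.real .theta < ((0 : ℕ) : ℝ)) ↔ x < 0
    simp [hs₁]
  rw [h1, h2]
  by_cases hlt : x < 0
  · rw [Cmd.exec_ite_pos (hcond.2 hlt)]
    refine ⟨?_, Nat.le_of_ble_eq_true rfl⟩
    have h3 : (Cmd.exec (.setReal .theta (.var .theta + 2 * .pi)) s₁).1 =
        { s with real := Function.update (Function.update s.real .theta x) .theta
                  (x + ((2 : ℕ) : ℝ) * Real.pi) } := rfl
    rw [h3, Function.update_idem, storedAngle, ← hx, if_pos hlt, Nat.cast_ofNat]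
  · rw [Cmd.exec_ite_neg (fun h => hlt (hcond.1 h))]
    refine ⟨?_, Nat.le_of_ble_eq_true rfl⟩
    change s₁ = _
    rw [storedAngle, ← hx, if_neg hlt]

end Algorithm

section Program

variable {n N : ℕ} {V : ℕ → Plane} {r θ : ℕ → ℝ} {s : State}

/-- The computed angles agree with `θ` up to multiples of `2π`. As `t + 2 * u < t + n`, the
difference of the `θ` values lies in `[0, 2π)`, so the normalization recovers exactly this
difference. -/
theorem Holds.storedAngle (h : Directions n V r θ) (hs : Holds n V s)
    {t u : ℕ} (hn : 0 < n) (ht : t < n) (hu : 2 * u < n) (hi : s.int .i = t)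
    (hj : s.int .j = (t + 2 * u + 1) % n) :
    Algorithm.storedAngle s = θ (t + 2 * u) - θ t := by
  have harg : ∀ k, ∃ m : ℤ, Complex.arg ⟨s.arr (.coord, (k + 1) % n, 0) - s.arr (.coord, k % n, 0),
      s.arr (.coord, (k + 1) % n, 1) - s.arr (.coord, k % n, 1)⟩ = θ k + 2 * Real.pi * m := by
    intro k
    rw [hs.xcoord, hs.ycoord, hs.xcoord, hs.ycoord, h.xstep, h.ystep]
    exact exists_arg_eq (h.pos k)
  obtain ⟨m₁, h₁⟩ := harg t
  obtain ⟨m₂, h₂⟩ := harg (t + 2 * u)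
  have hmono := h.strictMono.monotone (show t ≤ t + 2 * u by omega)
  have hlt := h.strictMono (show t + 2 * u < t + n by omega)
  rw [h.add_period] at hlt
  have e1 : (Algorithm.dir (Algorithm.bwd Algorithm.j 1) Algorithm.j).eval s =
      Complex.arg ⟨s.arr (.coord, (t + 2 * u + 1) % n, 0) - s.arr (.coord, (t + 2 * u) % n, 0),
        s.arr (.coord, (t + 2 * u + 1) % n, 1) - s.arr (.coord, (t + 2 * u) % n, 1)⟩ := by
    have : (s.int .j + (s.int .n - 1)) % s.int .n = (t + 2 * u) % n := by
      rw [hj, hs.size, mod_add_pred (by omega) (by omega)]; congr 1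
    rw [← this, ← hj]
    rfl
  have e2 : (Algorithm.dir Algorithm.i (Algorithm.fwd Algorithm.i 1)).eval s =
      Complex.arg ⟨s.arr (.coord, (t + 1) % n, 0) - s.arr (.coord, t % n, 0),
        s.arr (.coord, (t + 1) % n, 1) - s.arr (.coord, t % n, 1)⟩ := by
    rw [Nat.mod_eq_of_lt ht, ← hi, ← hs.size]
    rfl
  rw [Algorithm.storedAngle, e1, e2]
  exact shifted_sub_eq h₁ h₂ (Complex.neg_pi_lt_arg _) (Complex.arg_le_pi _)
    (Complex.neg_pi_lt_arg _) (Complex.arg_le_pi _) (by linarith) (by linarith)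

/-- The state after the table has been filled: the register `best` is an upper bound for the lengths
of the segments in some matching. -/
structure Ready (n : ℕ) (V : ℕ → Plane) (N : ℕ) (s : State) : Prop where
  holds : Holds n V s
  hasTable : HasTable n V N s
  matched : ∃ a, Matched V (s.real .best) a (a + n)

theorem Ready.congr {s' : State} (hs : Ready n V N s) (hn : s'.int .n = s.int .n)
    (ha : s'.arr = s.arr) (hf : s'.flag = s.flag)
    (hb : s'.real .best = s.real .best) : Ready n V N s' :=
  ⟨hs.holds.congr hn (fun p q => by rw [ha]), hs.hasTable.congr ha hf, by
    rw [hb]; exact hs.matched⟩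

theorem matched_min {x y : ℝ} (hx : ∃ a, Matched V x a (a + n)) (hy : ∃ a, Matched V y a (a + n)) :
    ∃ a, Matched V (min x y) a (a + n) := by
  rcases min_choice x y with h | h <;> rw [h] <;> assumption

theorem matched_table (hN : 1 ≤ N) (hn : n = 2 * N) (k : ℕ) :
    ∃ a, Matched V (table V (N - 1) k) a (a + n) := by
  have := (good_of_table_le (le_refl (table V (N - 1) k))).matched
  rw [show k + 2 * (N - 1) + 2 = k + n by omega] at this
  exact ⟨k, this⟩

theorem oneCascade_spec (hN : 1 ≤ N) (hn : n = 2 * N)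
    (hs : Holds n V s) (ht : HasTable n V N s) :
    Ready n V N (Algorithm.oneCascade.exec s).1 ∧
      (∀ k, (Algorithm.oneCascade.exec s).1.real .best ≤ table V (N - 1) (k + 1)) ∧
      (Algorithm.oneCascade.exec s).2 ≤ 103 + 101 * n := by
  have hread : ∀ k {s' : State}, HasTable n V N s' →
      s'.arr (.S, (k + 1) % n, k % n) = table V (N - 1) (k + 1) := by
    intro k s' hs'
    have := (hs' (N - 1) (by omega) (k + 1)).1
    rwa [show k + 1 + 2 * (N - 1) + 1 = k + n by omega, Nat.add_mod_right] at this
  set s₁ : State := { s with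
    real := Function.update s.real .best (s.arr (.S, (0 + 1) % s.int .n, 0)) } with hs₁
  have hbest : s₁.real .best = table V (N - 1) (0 + 1) := by
    have := hread 0 ht
    rw [Nat.zero_mod] at this
    rw [hs₁, hs.size, this]
    simp only [Function.update_self]
  have hr₁ : Ready n V N s₁ :=
    ⟨hs.congr rfl fun _ _ => rfl, ht.congr rfl rfl, by rw [hbest]; exact matched_table hN hn _⟩
  have key := Cmd.forLoop_spec (x := .i) (p := .var .n)
    (body := .setReal .best (.min (.var .best)
      (Algorithm.tab (Algorithm.fwd Algorithm.i 1) Algorithm.i))) (s := s₁) (m := n)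
    (c := fun _ => 100) (P := fun t s' => Ready n V N s' ∧
      ∀ k, k % n < t → s'.real .best ≤ table V (N - 1) (k + 1))
    hs.size ⟨hr₁, fun k hk => by omega⟩ ?_
  · obtain ⟨⟨h1, h2⟩, h3⟩ := key
    refine ⟨h1, fun k => h2 k (Nat.mod_lt _ (by omega)), ?_⟩
    rw [Finset.sum_const, Finset.card_range, smul_eq_mul] at h3
    have h4 : (Algorithm.oneCascade.exec s).2 = (Cmd.exec (.setReal .best
      (Algorithm.tab (Algorithm.fwd 0 1) 0)) s).2 + ((Cmd.exec (.forLoop .i (.var .n)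
        (.setReal .best (.min (.var .best)
          (Algorithm.tab (Algorithm.fwd Algorithm.i 1) Algorithm.i)))) s₁).2 + 1) := rfl
    have h5 : (Cmd.exec (.setReal .best (Algorithm.tab (Algorithm.fwd 0 1) 0)) s).2 ≤ 100 :=
      Nat.le_of_ble_eq_true rfl
    simp only [IExp.cost] at h3
    omega
  · rintro t s' htn ⟨hs', hP⟩
    refine ⟨?_, Nat.le_of_ble_eq_true rfl⟩
    have hexec : (Cmd.exec (.setReal .best (.min (.var .best)
        (Algorithm.tab (Algorithm.fwd Algorithm.i 1) Algorithm.i))) (s'.setInt .i t)).1 =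
        { s' with
          int := (s'.setInt .i t).int
          real := Function.update s'.real .best
            (min (s'.real .best) (s'.arr (.S, (t + 1) % s'.int .n, t))) } := rfl
    rw [hexec]
    have hval := hread t hs'.hasTable
    rw [Nat.mod_eq_of_lt htn] at hval
    rw [hs'.holds.size, hval]
    refine ⟨⟨hs'.holds.congr rfl fun _ _ => rfl, hs'.hasTable.congr rfl rfl, ?_⟩, fun k hk => ?_⟩
    · simp only [Function.update_self]
      exact matched_min hs'.matched (matched_table hN hn _)
    · simp only [Function.update_self]
      rcases Nat.lt_or_ge (k % n) t with hlt | hge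
      · exact min_le_of_left_le (hP k hlt)
      · have heq : k % n = t := by omega
        refine min_le_of_right_le (le_of_eq ?_)
        have h1 := hread k hs'.hasTable
        rw [← Nat.mod_add_mod, heq, hval] at h1
        exact h1

/-- The value tried for `i, …, i + 2 * d + 1` and the next `2 * e + 2` points. -/
def triedValue (V : ℕ → Plane) (N i d e : ℕ) : ℝ :=
  max (table V d i)
    (max (table V e (i + 2 * d + 2)) (table V (N - d - e - 3) (i + 2 * d + 2 * e + 4)))

theorem matched_triedValue (hn : n = 2 * N) {i d e : ℕ} (hde : d + e + 2 < N) :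
    Matched V (triedValue V N i d e) i (i + n) := by
  have h1 := (good_of_table_le (show table V d i ≤ triedValue V N i d e from
    le_max_left _ _)).matched
  have h2 := (good_of_table_le (show table V e (i + 2 * d + 2) ≤ triedValue V N i d e from
    (le_max_left _ _).trans (le_max_right _ _))).matched
  have h3 := (good_of_table_le (show table V (N - d - e - 3) (i + 2 * d + 2 * e + 4) ≤
    triedValue V N i d e from (le_max_right _ _).trans (le_max_right _ _))).matched
  rw [show i + 2 * d + 2 + 2 * e + 2 = i + 2 * d + 2 * e + 4 by ring] at h2
  rw [show i + 2 * d + 2 * e + 4 + 2 * (N - d - e - 3) + 2 = i + n by omega] at h3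
  exact (h1.append h2 (by omega) (by omega)).append h3 (by omega) (by omega)

theorem tryLoop_spec (hn : n = 2 * N) (hs : Ready n V N s)
    {t u : ℕ} (ht : t < n) (hu : u < N) (hi : s.int .i = t) (hd : s.int .d = u)
    (hj : s.int .j = (t + 2 * u + 1) % n) {s' : State}
    (hexec : s' =
      (Cmd.exec (.forLoop .e ((.var .n - (2 * .var .d + 2)) / 2) Algorithm.tryBody) s).1) :
    Ready n V N s' ∧ s'.int .i = t ∧ s'.real .best ≤ s.real .best ∧
      (∀ e, u + e + 2 < N → s'.real .best ≤ triedValue V N t u e) ∧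
      (Cmd.exec (.forLoop .e ((.var .n - (2 * .var .d + 2)) / 2) Algorithm.tryBody) s).2 ≤
        10 + 101 * N := by
  have key := Cmd.forLoop_spec (x := .e) (p := (.var .n - (2 * .var .d + 2)) / 2)
    (body := Algorithm.tryBody) (s := s) (m := N - u - 1) (c := fun _ => 100)
    (P := fun w s' => Ready n V N s' ∧ s'.int .i = t ∧ s'.int .j = (t + 2 * u + 1) % n ∧
      s'.real .best ≤ s.real .best ∧
      ∀ e < w, u + e + 2 < N → s'.real .best ≤ triedValue V N t u e)
    (by change (s.int .n - (2 * s.int .d + 2)) / 2 = N - u - 1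
        rw [hs.holds.size, hd]; omega)
    ⟨hs, hi, hj, le_rfl, fun e he => by omega⟩ ?_
  · obtain ⟨⟨h1, h2, -, h3, h4⟩, h5⟩ := key
    rw [← hexec] at h1 h2 h3 h4
    refine ⟨h1, h2, h3, fun e he => h4 e (by omega) he, h5.trans ?_⟩
    rw [Finset.sum_const, Finset.card_range, smul_eq_mul]
    have hc : ((.var .n - (2 * .var .d + 2)) / 2 : IExp).cost = 9 := rfl
    rw [hc]
    omega
  · rintro w s₁ hw ⟨hs₁, hi₁, hj₁, hb₁, hP⟩
    refine ⟨?_, Nat.le_of_ble_eq_true rfl⟩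
    set K := (s₁.int .j + 1 + (2 * w + 1)) % s₁.int .n with hK
    set X := max (s₁.arr (.S, s₁.int .i, s₁.int .j)) (max
      (s₁.arr (.S, (s₁.int .j + 1) % s₁.int .n, K))
      (s₁.arr (.S, (K + 1) % s₁.int .n, (s₁.int .i + (s₁.int .n - 1)) % s₁.int .n))) with hX
    have hexec : (Algorithm.tryBody.exec (s₁.setInt .e w)).1 =
        { s₁ with
          int := Function.update (s₁.setInt .e w).int .k K
          real := Function.update s₁.real .best (min (s₁.real .best) X) } := rfl
    rw [hexec]
    have htt : t % n = t := Nat.mod_eq_of_lt ht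
    have hT := hs₁.hasTable
    have hK' : K = (t + 2 * u + 2 * w + 3) % n := by
      rw [hK, hj₁, hs₁.holds.size, add_assoc, Nat.mod_add_mod]; ring_nf
    have r1 := (hT u hu t).1
    have r2 := (hT w (by omega) (t + 2 * u + 2)).1
    have ej : (s₁.int .j + 1) % n = (t + 2 * u + 2) % n := by
      rw [hj₁, Nat.mod_add_mod]
    have eK : (K + 1) % n = (t + 2 * u + 2 * w + 4) % n := by
      rw [hK', Nat.mod_add_mod]
    rw [show t + 2 * u + 2 + 2 * w + 1 = t + 2 * u + 2 * w + 3 by ring, ← hK', ← ej] at r2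
    rw [htt, ← hj₁] at r1
    rw [hi₁, hs₁.holds.size, r1, r2, eK] at hX
    have hXv : u + w + 2 < N → X = triedValue V N t u w := by
      intro hlt
      have r3 := (hT (N - u - w - 3) (by omega) (t + 2 * u + 2 * w + 4)).1
      rw [show t + 2 * u + 2 * w + 4 + 2 * (N - u - w - 3) + 1 = t + (n - 1) by omega] at r3
      rw [hX, r3]
      rfl
    -- The last `k` is `i - 1`, which leaves the third interval empty. The program then reads `S[i,
    -- i - 1]`, the entry of the whole cycle, so the tried value is still an upper bound for some
    -- matching.
    have hXm : ∃ a, Matched V X a (a + n) := by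
      rcases Nat.lt_or_ge (u + w + 2) N with hlt | hge
      · rw [hXv hlt]
        exact ⟨t, matched_triedValue hn hlt⟩
      · have r3 := (hT (N - 1) (by omega) (t + 2 * u + 2 * w + 4)).1
        rw [show t + 2 * u + 2 * w + 4 + 2 * (N - 1) + 1 = t + (n - 1) + n by omega,
          Nat.add_mod_right] at r3
        have hle : table V (N - 1) (t + 2 * u + 2 * w + 4) ≤ X := by
          rw [hX, r3]
          exact (le_max_right _ _).trans (le_max_right _ _)
        have := (good_of_table_le hle).matched
        rw [show t + 2 * u + 2 * w + 4 + 2 * (N - 1) + 2 = t + 2 * u + 2 * w + 4 + n by omega]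
          at this
        exact ⟨_, this⟩
    refine ⟨⟨hs₁.holds.congr rfl fun _ _ => rfl, hT.congr rfl rfl, ?_⟩, hi₁, hj₁, ?_, ?_⟩
    · simp only [Function.update_self]
      exact matched_min hs₁.matched hXm
    · simp only [Function.update_self]
      exact min_le_of_left_le hb₁
    · intro e he hlt
      simp only [Function.update_self]
      rcases Nat.lt_or_ge e w with hew | hew
      · exact min_le_of_left_le (hP e hew hlt)
      · obtain rfl : e = w := by omega
        exact min_le_of_right_le (hXv hlt).le

open Classical in
theorem pairBody_spec (hn : n = 2 * N) (h : Directions n V r θ)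
    (hs : Ready n V N s) {t u : ℕ} (ht : t < n) (hu : u < N) (hi : s.int .i = t)
    (hd : s.int .d = u) {s' : State} (hexec : s' = (Algorithm.pairBody.exec s).1) :
    Ready n V N s' ∧ s'.int .i = t ∧ s'.real .best ≤ s.real .best ∧
      (IsCandidate V θ u t → ∀ e, u + e + 2 < N → s'.real .best ≤ triedValue V N t u e) ∧
      (Algorithm.pairBody.exec s).2 ≤ 200 + 101 * N * (if IsCandidate V θ u t then 1 else 0) := by
  set s₁ : State := s.setInt .j ((s.int .i + (2 * s.int .d + 1)) % s.int .n) with hs₁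
  have hj₁ : s₁.int .j = (t + 2 * u + 1) % n := by
    change (s.int .i + (2 * s.int .d + 1)) % s.int .n = _
    rw [hi, hd, hs.holds.size, ← add_assoc]
  obtain ⟨hturn, hcost⟩ := Algorithm.turningAngle_exec s₁
  have hr₁ : Ready n V N s₁ := hs.congr rfl rfl rfl rfl
  have hangle := hr₁.holds.storedAngle h (by omega) ht (by omega) hi hj₁
  set s₂ : State := (Algorithm.turningAngle.exec s₁).1 with hs₂
  rw [hangle] at hturn
  have hr₂ : Ready n V N s₂ := hr₁.congr (by rw [hturn]) (by rw [hturn]) (by rw [hturn])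
    (by rw [hturn]; rfl)
  have hi₂ : s₂.int .i = t := by rw [hturn]; exact hi
  have hd₂ : s₂.int .d = u := by rw [hturn]; exact hd
  have hj₂ : s₂.int .j = (t + 2 * u + 1) % n := by rw [hturn]; exact hj₁
  have hb₂ : s₂.real .best = s.real .best := by rw [hturn]; rfl
  have hθ₂ : s₂.real .theta = θ (t + 2 * u) - θ t := by rw [hturn]; rfl
  have htest : Algorithm.candidateTest.eval s₂ ↔ IsCandidate V θ u t := by
    change (s₂.flag (.necessary, s₂.int .i, s₂.int .j) ∧
      s₂.real .theta ≤ ((2 : ℕ) : ℝ) * Real.pi / ((3 : ℕ) : ℝ)) ↔ _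
    have := (hr₂.hasTable u hu t).2
    rw [Nat.mod_eq_of_lt ht] at this
    rw [hi₂, hj₂, hθ₂, this]
    simp [IsCandidate]
  have h1 : (Algorithm.pairBody.exec s).1 = (Cmd.exec (.ite Algorithm.candidateTest
      (.forLoop .e ((.var .n - (2 * .var .d + 2)) / 2) Algorithm.tryBody) .skip) s₂).1 := rfl
  have h2 : (Algorithm.pairBody.exec s).2 = (Cmd.exec (.setInt .j
      (Algorithm.fwd Algorithm.i (2 * Algorithm.d + 1))) s).2 +
      ((Algorithm.turningAngle.exec s₁).2 + ((Cmd.exec (.ite Algorithm.candidateTest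
      (.forLoop .e ((.var .n - (2 * .var .d + 2)) / 2) Algorithm.tryBody) .skip) s₂).2 + 1)) := rfl
  have h3 : (Cmd.exec (.setInt .j (Algorithm.fwd Algorithm.i (2 * Algorithm.d + 1))) s).2 ≤ 20 :=
    Nat.le_of_ble_eq_true rfl
  have h4 : Algorithm.candidateTest.cost ≤ 20 := Nat.le_of_ble_eq_true rfl
  by_cases hc : IsCandidate V θ u t
  · rw [Cmd.exec_ite_pos (htest.2 hc)] at h1 h2
    obtain ⟨k1, k2, k3, k4, k5⟩ := tryLoop_spec hn hr₂ ht hu hi₂ hd₂ hj₂ rfl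
    rw [hexec, h1, h2, if_pos hc]
    refine ⟨k1, k2, by rw [← hb₂]; exact k3, fun _ => k4, ?_⟩
    dsimp only
    omega
  · rw [Cmd.exec_ite_neg (fun hh => hc (htest.1 hh))] at h1 h2
    rw [hexec, h1, h2, if_neg hc]
    have h5 : (Cmd.skip.exec s₂).2 = 1 := rfl
    refine ⟨hr₂, hi₂, hb₂.le, fun hh => absurd hh hc, ?_⟩
    dsimp only
    omega

theorem threeCascades_spec (hN : 1 ≤ N) (hn : n = 2 * N) (hV : ∀ k, V (k + n) = V k)
    (h : Directions n V r θ) (hs : Ready n V N s) {s' : State}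
    (hexec : s' = (Algorithm.threeCascades.exec s).1) :
    Ready n V N s' ∧ s'.real .best ≤ s.real .best ∧
      (∀ i < n, ∀ d < N, IsCandidate V θ d i → ∀ e, d + e + 2 < N →
        s'.real .best ≤ triedValue V N i d e) ∧
      (Algorithm.threeCascades.exec s).2 ≤ 600 * n ^ 2 := by
  classical
  have key := Cmd.forLoop_spec (x := .i) (p := .var .n)
    (body := .forLoop .d (.var .n / 2) Algorithm.pairBody) (s := s) (m := n)
    (c := fun t => 4 + ∑ u ∈ Finset.range N,
      (1 + (200 + 101 * N * (if IsCandidate V θ u t then 1 else 0))))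
    (P := fun t s' => Ready n V N s' ∧ s'.real .best ≤ s.real .best ∧
      ∀ i < t, ∀ d < N, IsCandidate V θ d i → ∀ e, d + e + 2 < N →
        s'.real .best ≤ triedValue V N i d e)
    hs.holds.size ⟨hs, le_rfl, fun i hi => by omega⟩ ?_
  · obtain ⟨⟨h1, h2, h3⟩, h4⟩ := key
    subst hexec
    refine ⟨h1, h2, h3, h4.trans ?_⟩
    -- The innermost loop runs for at most `3n` pairs, with a number of steps linear in `N` each.
    -- This keeps the triple loop quadratic.
    have hcount := sum_isCandidate_le hV h
    rw [show n / 2 = N by omega] at hcount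
    have hsum : ∑ t ∈ Finset.range n, (1 + (4 + ∑ u ∈ Finset.range N,
        (1 + (200 + 101 * N * (if IsCandidate V θ u t then 1 else 0))))) =
        n * (5 + N * 201) + 101 * N * ∑ t ∈ Finset.range n, ∑ u ∈ Finset.range N,
          (if IsCandidate V θ u t then 1 else 0) := by
      simp only [Finset.sum_add_distrib, Finset.sum_const, Finset.card_range, smul_eq_mul,
        Finset.mul_sum]
      ring
    rw [hsum]
    have h5 := Nat.mul_le_mul_left (101 * N) hcount
    simp only [IExp.cost]
    subst hn
    nlinarith
  · rintro t s₁ ht ⟨hs₁, hb₁, hP⟩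
    have key₂ := Cmd.forLoop_spec (x := .d) (p := .var .n / 2)
      (body := Algorithm.pairBody) (s := s₁.setInt .i t) (m := N)
      (c := fun u => 200 + 101 * N * (if IsCandidate V θ u t then 1 else 0))
      (P := fun u s' => Ready n V N s' ∧ s'.int .i = t ∧ s'.real .best ≤ s₁.real .best ∧
        ∀ d < u, IsCandidate V θ d t → ∀ e, d + e + 2 < N →
          s'.real .best ≤ triedValue V N t d e)
      (by change s₁.int .n / 2 = N; rw [hs₁.holds.size]; omega)
      ⟨hs₁.congr rfl rfl rfl rfl, rfl, le_rfl, fun i hi => by omega⟩ ?_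
    · obtain ⟨⟨h1, -, h2, h3⟩, h4⟩ := key₂
      refine ⟨⟨h1, h2.trans hb₁, fun i hi d hd hc e he => ?_⟩, h4⟩
      rcases Nat.lt_or_ge i t with hlt | hge
      · exact h2.trans (hP i hlt d hd hc e he)
      · obtain rfl : i = t := by omega
        exact h3 d hd hc e he
    · rintro u s₂ hu ⟨hs₂, hi₂, hb₂, hP₂⟩
      obtain ⟨k1, k2, k3, k4, k5⟩ := pairBody_spec hn h (s := s₂.setInt .d u) (t := t) (u := u)
        (hs₂.congr rfl rfl rfl rfl) ht hu hi₂ rfl rfl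
      refine ⟨⟨k1, k2, k3.trans hb₂, fun d hd hc e he => ?_⟩, k5⟩
      rcases Nat.lt_or_ge d u with hlt | hge
      · exact k3.trans (hP₂ d hlt hc e he)
      · obtain rfl : d = u := by omega
        exact k4 hc e he

/-! ## The algorithm -/

theorem triedValue_mod (hV : ∀ k, V (k + n) = V k) (i d e : ℕ) :
    triedValue V N (i % n) d e = triedValue V N i d e := by
  have key : ∀ d c, table V d (i % n + c) = table V d (i + c) := fun d c => by
    rw [← table_mod hV d (i % n + c), Nat.mod_add_mod, table_mod hV]
  have h0 := table_mod hV d i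
  simp only [triedValue, add_assoc, key, h0]

theorem isCandidate_mod (hV : ∀ k, V (k + n) = V k) (h : Directions n V r θ) (d k : ℕ) :
    IsCandidate V θ d (k % n) ↔ IsCandidate V θ d k :=
  Iff.of_eq <| Function.Periodic.map_mod_nat (f := IsCandidate V θ d)
    (fun k => propext (isCandidate_add_period hV h d k)) k

theorem bottleneckMatching_spec (hN : 1 ≤ N) (hn : n = 2 * N) (hV : ∀ k, V (k + n) = V k)
    (h : Directions n V r θ) (hs : Holds n V s) {s' : State}
    (hexec : s' = (Algorithm.bottleneckMatching.exec s).1) :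
    (∃ a, Matched V (s'.real .best) a (a + n)) ∧
      (∀ k, s'.real .best ≤ table V (N - 1) k) ∧
      (∀ i d e, IsCandidate V θ d i → d + e + 2 < N → s'.real .best ≤ triedValue V N i d e) ∧
      (Algorithm.bottleneckMatching.exec s).2 ≤ 2000 * n ^ 2 := by
  set s₁ := (Algorithm.initTable.exec s).1 with hs₁
  set s₂ := (Algorithm.fillTable.exec s₁).1 with hs₂
  set s₃ := (Algorithm.oneCascade.exec s₂).1 with hs₃
  have h1 : s' = (Algorithm.threeCascades.exec s₃).1 := hexec
  have h2 : (Algorithm.bottleneckMatching.exec s).2 = (Algorithm.initTable.exec s).2 +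
      ((Algorithm.fillTable.exec s₁).2 + ((Algorithm.oneCascade.exec s₂).2 +
        ((Algorithm.threeCascades.exec s₃).2 + 1))) := rfl
  obtain ⟨a1, a2, a3⟩ := initTable_spec (by omega) hs
  obtain ⟨b1, b2, b3⟩ := fillTable_spec hN hn hV a1 a2
  obtain ⟨c1, c2, c3⟩ := oneCascade_spec hN hn b1 b2
  obtain ⟨d1, d2, d3, d4⟩ := threeCascades_spec hN hn hV h c1 h1
  refine ⟨d1.matched, fun k => d2.trans ?_, fun i d e hc hde => ?_, ?_⟩
  · rw [← table_add_period hV, show k + n = k + (n - 1) + 1 by omega]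
    exact c2 _
  · rw [← triedValue_mod hV]
    exact d3 (i % n) (Nat.mod_lt _ (by omega)) d (by omega) ((isCandidate_mod hV h d i).2 hc) e hde
  · rw [h2]
    subst hn
    nlinarith

end Program

end Bottleneck

end

/-! ### Correctness and running time of the whole algorithm -/

open Bottleneck in
theorem mainTheorem1 :
    ∃ C : ℕ, ∀ (n : ℕ), 0 < n → Even n →
      ∀ v : Fin n → Bottleneck.Plane, Bottleneck.IsConvexCCW v →
        ∀ s : Bottleneck.State, Bottleneck.IsInput v s →
          IsLeast (Bottleneck.matchingValues v)
              ((Bottleneck.Algorithm.bottleneckMatching.exec s).1.real .best) ∧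
            (Bottleneck.Algorithm.bottleneckMatching.exec s).2 ≤ C * n ^ 2 := by
  refine ⟨2000, fun n hn hev v hv s hs => ?_⟩
  obtain ⟨N, hN⟩ := hev
  have hN1 : 1 ≤ N := by omega
  have hnN : n = 2 * N := by omega
  have hC := hv.convexLift (by omega)
  set V := lift hn v with hVdef
  obtain ⟨θ, hθ⟩ := hC.exists_directions
  have hH : Holds n V s := ⟨hs.size, fun k => hs.xcoord ⟨k % n, Nat.mod_lt k hn⟩,
    fun k => hs.ycoord ⟨k % n, Nat.mod_lt k hn⟩⟩
  obtain ⟨⟨a, h1⟩, h2, h3, h4⟩ := bottleneckMatching_spec hN1 hnN hC.periodic hθ hH rfl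
  set best := (Algorithm.bottleneckMatching.exec s).1.real .best
  have hlower : ∀ σ l, IsNonCrossingMatching v σ → (∀ i, dist (v i) (v (σ i)) ≤ l) → best ≤ l := by
    intro σ l hσ hl
    rcases (hσ.isPartner hn hC hl).exists_solution hC.periodic hn hθ with ⟨i, hi⟩ |
      ⟨i, d, e, hde, hc, g1, g2, g3⟩
    · exact (h2 i).trans (hi.table_le (N - 1) (by omega))
    · refine (h3 i d e hc (by omega)).trans (max_le (g1.table_le d rfl) (max_le ?_ ?_))
      · exact g2.table_le e (by ring)
      · exact g3.table_le _ (by omega)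
  refine ⟨⟨?_, ?_⟩, h4⟩
  · obtain ⟨σ, hσ, hle⟩ := h1.exists_isNonCrossingMatching hn hC
    refine ⟨σ, hσ, ?_, ?_⟩
    · have : Nonempty (Fin n) := ⟨⟨0, hn⟩⟩
      obtain ⟨i, hi⟩ := Finite.exists_max fun i => dist (v i) (v (σ i))
      -- The longest segment of this matching is at most `best` by construction; its length is
      -- itself a bound for a matching, so it is at least `best`.
      exact ⟨i, le_antisymm (hle i) (hlower σ _ hσ hi)⟩
    · rintro _ ⟨i, rfl⟩
      exact hle i
  · rintro b ⟨σ, hσ, hb⟩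
    exact hlower σ b hσ fun i => hb.2 ⟨i, rfl⟩
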